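/- **Automata.** Let $\Sigma$ be a finite nonempty alphabet. An alternating parity automaton over $\Sigma$ is $\mathcal A=(\Sigma,Q,\iota,\delta,\alpha)$ with a finite set $Q$ of states, an initial state $\iota\in Q$, a transition function $\delta$ that maps each $(q,a)\in Q\times\Sigma$ to a positive Boolean formula over $Q$ (built from elements of $Q$ by $\lor$ and $\land$), and a priority labelling $\alpha\colon Q\times\Sigma\times Q\to\Gamma$ with $\Gamma\subseteq\mathbb N$ finite; it is then a $\Gamma$-parity automaton. It is nondeterministic (universal) if all formulas $\delta(q,a)$ are disjunctions (conjunctions) of states. Its size is the maximum of $|\Sigma|$, $|Q|$, $|\Gamma|$ and the sum of the lengths of all formulas $\delta(q,a)$. **Games.** In a round from a state $q$ over a letter $a$, Eve and Adam go down the formula $\delta(q,a)$, Eve resolving disjunctions and Adam resolving conjunctions, until a state $q'$ is reached, where the next round starts. Infinitely many rounds, starting from $\iota$, over the successive letters of a word $w\in\Sigma^\omega$ produce a path of $\mathcal A$ on $w$; it is accepting if the highest priority $\alpha(q,a,q')$ occurring infinitely often on it is even. Strategies may depend on the whole history of the play. $L(\mathcal A)$ is the set of all $w\in\Sigma^\omega$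 such that, in the game over the fixed word $w$, Eve has a strategy which ensures that the path is accepting. In Eve's letter game, each round starts with Adam choosing a letter $a$, and is then played over $a$; Eve wins if the generated word $w$ is not in $L(\mathcal A)$ or the generated path is accepting. In Adam's letter game, Eve chooses the letters, and Adam wins if $w\in L(\mathcal A)$ or the path is not accepting. $\mathcal A$ is good for games (GFG) if Eve has a winning strategy in her letter game and Adam has a winning strategy in his. **Statement.** There are a finite nonempty alphabet $\Sigma$, a family $(\mathcal C_n)_{n\in\mathbb N}$ of alternating GFG $\{0,1,2\}$-parity automata over $\Sigma$ such that the size of $\mathcal C_n$ is linear in $n$ (that is, $\Theta(n)$), and a constant $c>0$ such that, for all sufficiently large $n$, every nondeterministic GFG parity automaton and every universal GFG parity automaton over $\Sigma$ with language $L(\mathcal C_n)$ has size at least $2^{cn}$. -/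

import Mathlib

open Filter Asymptotics

/-- Positive Boolean formulas over `Q` (the transition conditions of an alternating automaton):
built from the elements of `Q` by disjunction and conjunction. -/
inductive PosFormula (Q : Type) : Type where
  | atom : Q → PosFormula Q
  | or : PosFormula Q → PosFormula Q → PosFormula Q
  | and : PosFormula Q → PosFormula Q → PosFormula Q

namespace PosFormula

variable {Q : Type}

/-- The length of a formula: the number of occurrences of atoms and connectives. -/
def length : PosFormula Q → ℕ
  | atom _ => 1
  | or φ ψ => φ.length + ψ.length + 1
  | and φ ψ => φ.length + ψ.length + 1

/-- The formula is a disjunction of atoms. -/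
def IsDisjunction : PosFormula Q → Prop
  | atom _ => True
  | or φ ψ => φ.IsDisjunction ∧ ψ.IsDisjunction
  | and _ _ => False

/-- The formula is a conjunction of atoms. -/
def IsConjunction : PosFormula Q → Prop
  | atom _ => True
  | or _ _ => False
  | and φ ψ => φ.IsConjunction ∧ ψ.IsConjunction

/-- The subformula reached by going down the formula along a list of directions
(`false` is left, `true` is right), if there is one. -/
def follow : PosFormula Q → List Bool → Option (PosFormula Q)
  | φ, [] => some φ
  | atom _, _ :: _ => none
  | or φ ψ, b :: u => if b then ψ.follow u else φ.follow u
  | and φ ψ, b :: u => if b then ψ.follow u else φ.follow u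

/-- The formula is a disjunction at its root: a position of Eve. -/
def IsOr (φ : PosFormula Q) : Prop := ∃ φ₁ φ₂, φ = or φ₁ φ₂

/-- The formula is a conjunction at its root: a position of Adam. -/
def IsAnd (φ : PosFormula Q) : Prop := ∃ φ₁ φ₂, φ = and φ₁ φ₂

end PosFormula

/-- The max-parity condition on a bounded sequence of priorities: the highest priority that occurs
infinitely often is even. -/
def ParityAccepting (c : ℕ → ℕ) : Prop :=
  ∃ k, Even k ∧ (∃ᶠ i in atTop, c i = k) ∧ ∀ᶠ i in atTop, c i ≤ k

/-- Alternating parity automata on infinite words over the alphabet `A`, with acceptance on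
transitions. The set of states is nonempty because of `init`. -/
structure AltParityAutomaton (A : Type) where
  State : Type
  [fintypeState : Fintype State]
  init : State
  δ : State → A → PosFormula State
  /-- the finite set `Γ` of priorities -/
  priorities : Finset ℕ
  /-- the labelling `α` of the transitions `(q, a, q')` -/
  priority : State → A → State → ℕ
  priority_mem : ∀ q a q', priority q a q' ∈ priorities

/-- A strategy of one of the two players for resolving that player's choices in transition
conditions. It sees the history of the play: the earlier rounds (the letter of each round and the
directions taken by both players in the transition condition), the letter of the current round and
the directions taken so far in the current round. It answers with a direction. -/
def ChoiceStrategy (A : Type) : Type := List (A × List Bool) → A → List Bool → Bool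

namespace AltParityAutomaton

variable {A : Type}

/-- The size: the maximum of the number of letters, the number of states, the sum of the lengths of
all transition conditions, and the number of priorities. -/
def size [Fintype A] (M : AltParityAutomaton A) : ℕ :=
  letI := M.fintypeState
  max (Fintype.card A) (max (Fintype.card M.State)
    (max (∑ q : M.State, ∑ a : A, (M.δ q a).length) M.priorities.card))

def IsNondeterministic (M : AltParityAutomaton A) : Prop := ∀ q a, (M.δ q a).IsDisjunction

def IsUniversal (M : AltParityAutomaton A) : Prop := ∀ q a, (M.δ q a).IsConjunction

/-- A path of `M` on the infinite word `w`, as a play: in round `i`, from state `state i`, the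
players go down the transition condition over the letter `w i` along the directions `branch i`
and reach the atom `state (i + 1)`. -/
structure Play (M : AltParityAutomaton A) (w : ℕ → A) where
  state : ℕ → M.State
  branch : ℕ → List Bool
  state_zero : state 0 = M.init
  step : ∀ i, (M.δ (state i) (w i)).follow (branch i) = some (.atom (state (i + 1)))

namespace Play

variable {M : AltParityAutomaton A} {w : ℕ → A}

/-- The rounds before round `i`. -/
def history (ρ : M.Play w) (i : ℕ) : List (A × List Bool) :=
  (List.range i).map fun j => (w j, ρ.branch j)

/-- The sequence of transitions satisfies the acceptance condition of the automaton. -/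
def IsAccepting (ρ : M.Play w) : Prop :=
  ParityAccepting fun i => M.priority (ρ.state i) (w i) (ρ.state (i + 1))

/-- All disjunctions met in the play are resolved by the strategy `σ` of Eve. -/
def EveFollows (ρ : M.Play w) (σ : ChoiceStrategy A) : Prop :=
  ∀ (i : ℕ) (u : List Bool) (b : Bool) (v : List Bool) (φ : PosFormula M.State),
    ρ.branch i = u ++ b :: v → (M.δ (ρ.state i) (w i)).follow u = some φ → φ.IsOr →
      b = σ (ρ.history i) (w i) u

/-- All conjunctions met in the play are resolved by the strategy `τ` of Adam. -/
def AdamFollows (ρ : M.Play w) (τ : ChoiceStrategy A) : Prop :=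
  ∀ (i : ℕ) (u : List Bool) (b : Bool) (v : List Bool) (φ : PosFormula M.State),
    ρ.branch i = u ++ b :: v → (M.δ (ρ.state i) (w i)).follow u = some φ → φ.IsAnd →
      b = τ (ρ.history i) (w i) u

end Play

/-- `M` accepts `w`: Eve has a winning strategy in the model-checking game of `M` and `w`. (The
word is fixed before the strategy is chosen.) -/
def Accepts (M : AltParityAutomaton A) (w : ℕ → A) : Prop :=
  ∃ σ : ChoiceStrategy A, ∀ ρ : M.Play w, ρ.EveFollows σ → ρ.IsAccepting

/-- The language of `M`. -/
def language (M : AltParityAutomaton A) : Set (ℕ → A) := {w | M.Accepts w}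

/-- Eve wins her letter game: Adam chooses the letters and resolves conjunctions, Eve resolves
disjunctions with a strategy that sees only the history, and every play that follows her strategy
generates a word outside of the language or an accepting path. -/
def IsExistsGFG (M : AltParityAutomaton A) : Prop :=
  ∃ σ : ChoiceStrategy A, ∀ (w : ℕ → A) (ρ : M.Play w), ρ.EveFollows σ →
    w ∉ M.language ∨ ρ.IsAccepting

/-- Adam wins his letter game: Eve chooses the letters and resolves disjunctions, Adam resolves
conjunctions with a strategy that sees only the history, and every play that follows his strategy
generates a word in the language or a rejecting path. -/
def IsForallGFG (M : AltParityAutomaton A) : Prop :=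
  ∃ τ : ChoiceStrategy A, ∀ (w : ℕ → A) (ρ : M.Play w), ρ.AdamFollows τ →
    w ∈ M.language ∨ ¬ ρ.IsAccepting

/-- `M` is good for games. -/
def IsGFG (M : AltParityAutomaton A) : Prop := M.IsExistsGFG ∧ M.IsForallGFG

end AltParityAutomaton

/-! The letters generate all permutations of `2n+2` tracks, and one further letter cuts the track
that stands at position `0`. In `trackLanguage`, the first letter decides whether some track must be
cut only finitely often, or every track infinitely often.

Upper bound. An alternating automaton only stores a side and the position of one followed track.
When this track is cut, Eve (if some track must survive) or Adam (if all must be cut) picks a new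
one. Trying the tracks in cyclic order needs no knowledge of the future: if some track is cut
finitely often, the choice eventually stays on one track forever. So the same round-robin strategy
wins both letter games.

Lower bound. For a nondeterministic GFG automaton, Eve's strategy gives one run on finite words that
is accepting on every word of the language, while accepting paths exist on no other words. For a
universal one, Adam's strategy does the same for the complement, once all priorities are raised by
one. In both cases a suitable first letter turns the language into "all tracks are cut infinitely
often". `TrackRun` records this common situation, and `TrackRun.choose_le_card_states` shows that it
needs a central binomial coefficient of states.

For this, let `P` be a priority that is not exceeded after some word and that recurs whatever
extension follows. Some extension cuts all tracks infinitely often and meets `P` infinitely often,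
so `P` is even (`even_of_bounded`). Then no pair of state and track can return to itself through
maximal priority `P` without a cut, as repeating the cycle would accept a word with a surviving
track (`not_descends_self`). Hence pairs have a finite rank that never grows on an uncut track and
drops when `P` is met. For the least threshold below which at least half of the tracks can be
brought, the number of low tracks must at some point be exactly half: otherwise meeting `P` would
give a smaller threshold (`choose_le_card_of_even`). Cut-free words then move the low tracks to
every half of the positions, and the state determines the set of low tracks (`choose_le_card`). -/

/-- The first `i` letters of an infinite word. -/
def wordPrefix {A : Type} (w : ℕ → A) (i : ℕ) : List A := (List.range i).map w

theorem wordPrefix_succ {A : Type} (w : ℕ → A) (i : ℕ) :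
    wordPrefix w (i + 1) = wordPrefix w i ++ [w i] := by
  simp [wordPrefix, List.range_succ]

theorem length_wordPrefix {A : Type} (w : ℕ → A) (i : ℕ) : (wordPrefix w i).length = i := by
  simp [wordPrefix]

/-! ### Resolving formulas by strategies. -/

namespace PosFormula

variable {Q : Type}

/-- The directions taken in a formula, and the atom reached, when `f` resolves the disjunctions
and `g` the conjunctions; `u` lists the directions taken earlier. -/
def resolve (f g : List Bool → Bool) : PosFormula Q → List Bool → List Bool × Q
  | atom q, _ => ([], q)
  | or φ ψ, u =>
    let r := if f u then resolve f g ψ (u ++ [f u]) else resolve f g φ (u ++ [f u])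
    (f u :: r.1, r.2)
  | and φ ψ, u =>
    let r := if g u then resolve f g ψ (u ++ [g u]) else resolve f g φ (u ++ [g u])
    (g u :: r.1, r.2)

theorem follow_resolve (f g : List Bool → Bool) (φ : PosFormula Q) (u : List Bool) :
    φ.follow (φ.resolve f g u).1 = some (atom (φ.resolve f g u).2) := by
  induction φ generalizing u with
  | atom q => rfl
  | or φ ψ hφ hψ => cases h : f u <;> simp [resolve, follow, h, hφ, hψ]
  | and φ ψ hφ hψ => cases h : g u <;> simp [resolve, follow, h, hφ, hψ]

theorem resolve_isOr (f g : List Bool → Bool) {φ : PosFormula Q} {u p v : List Bool} {b : Bool}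
    {χ : PosFormula Q} (hb : (φ.resolve f g u).1 = p ++ b :: v) (hp : φ.follow p = some χ)
    (hχ : χ.IsOr) : b = f (u ++ p) := by
  induction φ generalizing u p with
  | atom q => simp [resolve] at hb
  | or φ ψ hφ hψ =>
    cases p with
    | nil => simp [resolve] at hb; simp [hb.1]
    | cons d p =>
      simp only [resolve, List.cons_append, List.cons.injEq] at hb
      obtain ⟨rfl, hb⟩ := hb
      cases h : f u <;> simp only [h, follow, if_true, if_false, Bool.false_eq_true] at hb hp
      · simpa using hφ hb hp
      · simpa using hψ hb hp
  | and φ ψ hφ hψ =>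
    cases p with
    | nil =>
      simp only [follow, Option.some.injEq] at hp
      obtain ⟨_, _, h⟩ := hχ
      simp [h] at hp
    | cons d p =>
      simp only [resolve, List.cons_append, List.cons.injEq] at hb
      obtain ⟨rfl, hb⟩ := hb
      cases h : g u <;> simp only [h, follow, if_true, if_false, Bool.false_eq_true] at hb hp
      · simpa using hφ hb hp
      · simpa using hψ hb hp

theorem resolve_isAnd (f g : List Bool → Bool) {φ : PosFormula Q} {u p v : List Bool} {b : Bool}
    {χ : PosFormula Q} (hb : (φ.resolve f g u).1 = p ++ b :: v) (hp : φ.follow p = some χ)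
    (hχ : χ.IsAnd) : b = g (u ++ p) := by
  induction φ generalizing u p with
  | atom q => simp [resolve] at hb
  | and φ ψ hφ hψ =>
    cases p with
    | nil => simp [resolve] at hb; simp [hb.1]
    | cons d p =>
      simp only [resolve, List.cons_append, List.cons.injEq] at hb
      obtain ⟨rfl, hb⟩ := hb
      cases h : g u <;> simp only [h, follow, if_true, if_false, Bool.false_eq_true] at hb hp
      · simpa using hφ hb hp
      · simpa using hψ hb hp
  | or φ ψ hφ hψ =>
    cases p with
    | nil =>
      simp only [follow, Option.some.injEq] at hp
      obtain ⟨_, _, h⟩ := hχ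
      simp [h] at hp
    | cons d p =>
      simp only [resolve, List.cons_append, List.cons.injEq] at hb
      obtain ⟨rfl, hb⟩ := hb
      cases h : f u <;> simp only [h, follow, if_true, if_false, Bool.false_eq_true] at hb hp
      · simpa using hφ hb hp
      · simpa using hψ hb hp

theorem IsDisjunction.of_follow {φ χ : PosFormula Q} {u : List Bool} (h : φ.IsDisjunction)
    (hu : φ.follow u = some χ) : χ.IsDisjunction := by
  induction φ generalizing u with
  | atom q =>
    cases u with
    | nil => simp only [follow, Option.some.injEq] at hu; exact hu ▸ h
    | cons b u => simp [follow] at hu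
  | or φ ψ hφ hψ =>
    cases u with
    | nil => simp only [follow, Option.some.injEq] at hu; exact hu ▸ h
    | cons b u => cases b <;> simp [follow] at hu; exacts [hφ h.1 hu, hψ h.2 hu]
  | and φ ψ => exact h.elim

theorem IsConjunction.of_follow {φ χ : PosFormula Q} {u : List Bool} (h : φ.IsConjunction)
    (hu : φ.follow u = some χ) : χ.IsConjunction := by
  induction φ generalizing u with
  | atom q =>
    cases u with
    | nil => simp only [follow, Option.some.injEq] at hu; exact hu ▸ h
    | cons b u => simp [follow] at hu
  | and φ ψ hφ hψ =>
    cases u with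
    | nil => simp only [follow, Option.some.injEq] at hu; exact hu ▸ h
    | cons b u => cases b <;> simp [follow] at hu; exacts [hφ h.1 hu, hψ h.2 hu]
  | or φ ψ => exact h.elim

/-- In a disjunction, directions that agree with a maximal branch at every disjunction are equal
to it. -/
theorem IsDisjunction.eq_of_agree {φ : PosFormula Q} (h : φ.IsDisjunction) {b b' : List Bool}
    {q q' : Q} (hb : φ.follow b = some (atom q)) (hb' : φ.follow b' = some (atom q'))
    (hagree : ∀ u c v χ, b' = u ++ c :: v → φ.follow u = some χ → χ.IsOr →
      c = b.getD u.length false) : b' = b ∧ q' = q := by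
  induction φ generalizing b b' with
  | atom r =>
    cases b with
    | cons _ _ => simp [follow] at hb
    | nil =>
      cases b' with
      | cons _ _ => simp [follow] at hb'
      | nil => simp [follow] at hb hb'; exact ⟨rfl, by rw [← hb, ← hb']⟩
  | and φ ψ => exact h.elim
  | or φ ψ hφ hψ =>
    cases b with
    | nil => simp [follow] at hb
    | cons d b =>
      cases b' with
      | nil => simp [follow] at hb'
      | cons d' b' =>
        obtain rfl : d' = d := by
          simpa using hagree [] d' b' _ rfl rfl ⟨φ, ψ, rfl⟩
        cases d'
        · simp only [follow, Bool.false_eq_true, if_false] at hb hb'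
          have := hφ h.1 hb hb' fun u c v χ h1 h2 h3 => by
            simpa using hagree (false :: u) c v χ (by simp [h1]) (by simpa [follow] using h2) h3
          simpa using this
        · simp only [follow, if_true] at hb hb'
          have := hψ h.2 hb hb' fun u c v χ h1 h2 h3 => by
            simpa using hagree (true :: u) c v χ (by simp [h1]) (by simpa [follow] using h2) h3
          simpa using this

end PosFormula

/-! ### Plays determined by strategies, and paths of nondeterministic and universal automata. -/

namespace AltParityAutomaton

variable {A : Type} (M : AltParityAutomaton A)

/-- One round from a state after a history, over a given letter. -/
def runStep (σ τ : ChoiceStrategy A) (s : M.State × List (A × List Bool)) (a : A) :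
    M.State × List (A × List Bool) :=
  (((M.δ s.1 a).resolve (σ s.2 a) (τ s.2 a) []).2,
    s.2 ++ [(a, ((M.δ s.1 a).resolve (σ s.2 a) (τ s.2 a) []).1)])

/-- The state and the history after the rounds over a finite word. -/
def run (σ τ : ChoiceStrategy A) (x : List A) : M.State × List (A × List Bool) :=
  x.foldl (M.runStep σ τ) (M.init, [])

theorem run_concat (σ τ : ChoiceStrategy A) (x : List A) (a : A) :
    M.run σ τ (x ++ [a]) = M.runStep σ τ (M.run σ τ x) a := by
  simp [run]

/-- The play on `w` determined by strategies of both players. -/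
def playOf (σ τ : ChoiceStrategy A) (w : ℕ → A) : M.Play w where
  state i := (M.run σ τ (wordPrefix w i)).1
  branch i := ((M.δ (M.run σ τ (wordPrefix w i)).1 (w i)).resolve
    (σ (M.run σ τ (wordPrefix w i)).2 (w i)) (τ (M.run σ τ (wordPrefix w i)).2 (w i)) []).1
  state_zero := rfl
  step i := by
    rw [wordPrefix_succ, run_concat]
    exact PosFormula.follow_resolve _ _ _ _

theorem history_playOf (σ τ : ChoiceStrategy A) (w : ℕ → A) (i : ℕ) :
    (M.playOf σ τ w).history i = (M.run σ τ (wordPrefix w i)).2 := by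
  induction i with
  | zero => rfl
  | succ i ih =>
    rw [wordPrefix_succ, run_concat, runStep, ← ih]
    simp only [Play.history, List.range_succ, List.map_append, List.map_cons, List.map_nil]
    congr 3
    rw [← Play.history, ih]; rfl

theorem eveFollows_playOf (σ τ : ChoiceStrategy A) (w : ℕ → A) :
    (M.playOf σ τ w).EveFollows σ := by
  intro i u b v φ hb hu hφ
  rw [history_playOf]
  simpa using PosFormula.resolve_isOr _ _ hb hu hφ

theorem adamFollows_playOf (σ τ : ChoiceStrategy A) (w : ℕ → A) :
    (M.playOf σ τ w).AdamFollows τ := by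
  intro i u b v φ hb hu hφ
  rw [history_playOf]
  simpa using PosFormula.resolve_isAnd _ _ hb hu hφ

theorem Play.history_map_fst {M : AltParityAutomaton A} {w : ℕ → A} (ρ : M.Play w) (i : ℕ) :
    (ρ.history i).map Prod.fst = wordPrefix w i := by
  simp [Play.history, wordPrefix, Function.comp_def]

/-- Strategies of the two players that win for the membership in `K` of the generated word show
that the automaton is good for games and that its language is `K`. -/
theorem isGFG_and_language_eq {M : AltParityAutomaton A} {K : Set (ℕ → A)}
    {σ τ : ChoiceStrategy A}
    (hσ : ∀ w ∈ K, ∀ ρ : M.Play w, ρ.EveFollows σ → ρ.IsAccepting)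
    (hτ : ∀ w ∉ K, ∀ ρ : M.Play w, ρ.AdamFollows τ → ¬ ρ.IsAccepting) :
    M.IsGFG ∧ M.language = K := by
  have hK : M.language = K := by
    ext w
    refine ⟨fun ⟨σ', h⟩ => ?_, fun hw => ⟨σ, hσ w hw⟩⟩
    by_contra hw
    exact hτ w hw _ (M.adamFollows_playOf σ' τ w) (h _ (M.eveFollows_playOf σ' τ w))
  refine ⟨⟨⟨σ, fun w ρ hρ => ?_⟩, ⟨τ, fun w ρ hρ => ?_⟩⟩, hK⟩
  · by_cases hw : w ∈ K
    · exact Or.inr (hσ w hw ρ hρ)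
    · exact Or.inl (hK ▸ hw)
  · by_cases hw : w ∈ K
    · exact Or.inl (hK ▸ hw)
    · exact Or.inr (hτ w hw ρ hρ)

/-- `q'` occurs as an atom in the transition condition of `q` over `a`. -/
def Transition (q : M.State) (a : A) (q' : M.State) : Prop :=
  ∃ b, (M.δ q a).follow b = some (.atom q')

theorem transition_run (σ τ : ChoiceStrategy A) (x : List A) (a : A) :
    M.Transition (M.run σ τ x).1 a (M.run σ τ (x ++ [a])).1 := by
  rw [run_concat]
  exact ⟨_, PosFormula.follow_resolve _ _ _ _⟩

/-- A nondeterministic automaton accepts every word with an accepting path. -/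
theorem IsNondeterministic.mem_language {M : AltParityAutomaton A} (hM : M.IsNondeterministic)
    {w : ℕ → A} {s : ℕ → M.State} (h0 : s 0 = M.init)
    (hs : ∀ i, M.Transition (s i) (w i) (s (i + 1)))
    (hacc : ParityAccepting fun i => M.priority (s i) (w i) (s (i + 1))) : w ∈ M.language := by
  choose b hb using hs
  -- The word is fixed, so Eve can replay the directions of the given path, indexed by the round
  -- number `h.length`. The default `false` is never used along the resulting play.
  refine ⟨fun h _ u => (b h.length).getD u.length false, fun ρ hρ => ?_⟩
  have key : ∀ i, ρ.state i = s i := by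
    intro i
    induction i with
    | zero => rw [ρ.state_zero, h0]
    | succ i ih =>
      have h1 := ρ.step i
      have h2 := hρ i
      rw [ih] at h1 h2
      refine (PosFormula.IsDisjunction.eq_of_agree (hM (s i) (w i)) (hb i) h1 ?_).2
      intro u c v χ hu hf hχ
      simpa [Play.history] using h2 u c v χ hu hf hχ
  simpa only [Play.IsAccepting, key] using hacc

/-- Every path of a universal automaton on a word of its language is accepting. -/
theorem IsUniversal.accepting {M : AltParityAutomaton A} (hM : M.IsUniversal)
    {w : ℕ → A} {s : ℕ → M.State} (h0 : s 0 = M.init)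
    (hs : ∀ i, M.Transition (s i) (w i) (s (i + 1))) (hw : w ∈ M.language) :
    ParityAccepting fun i => M.priority (s i) (w i) (s (i + 1)) := by
  choose b hb using hs
  obtain ⟨σ, hσ⟩ := hw
  refine hσ ⟨s, b, h0, hb⟩ ?_
  -- A conjunction contains no disjunction, so every path follows every strategy of Eve.
  rintro i u c v φ - hu ⟨φ₁, φ₂, rfl⟩
  exact ((hM _ _).of_follow hu).elim

end AltParityAutomaton

/-! ### The parity condition. -/

theorem exists_limsup_of_bounded {c : ℕ → ℕ} {B : ℕ} (hB : ∀ i, c i ≤ B) :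
    ∃ k, (∃ᶠ i in atTop, c i = k) ∧ ∀ᶠ i in atTop, c i ≤ k := by
  classical
  have hex : ∃ k, ∀ᶠ i in atTop, c i ≤ k := ⟨B, Eventually.of_forall hB⟩
  refine ⟨Nat.find hex, ?_, Nat.find_spec hex⟩
  by_contra h
  rw [not_frequently] at h
  have h1 := (Nat.find_spec hex).and h
  obtain ⟨i, hi⟩ := h1.exists
  have hpos : 0 < Nat.find hex := by omega
  refine Nat.find_min hex (m := Nat.find hex - 1) (by omega) ?_
  filter_upwards [h1] with i hi
  omega

theorem ParityAccepting.eq_limsup {c : ℕ → ℕ} {k : ℕ} (h : ParityAccepting c)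
    (hk : ∃ᶠ i in atTop, c i = k) (hk' : ∀ᶠ i in atTop, c i ≤ k) : Even k := by
  obtain ⟨l, hl, h1, h2⟩ := h
  obtain ⟨i, hi, hi'⟩ := (hk.and_eventually h2).exists
  obtain ⟨j, hj, hj'⟩ := (h1.and_eventually hk').exists
  obtain rfl : k = l := by omega
  exact hl

/-- Increasing all priorities by one exchanges accepting and rejecting sequences. -/
theorem parityAccepting_add_one_iff {c : ℕ → ℕ} {B : ℕ} (hB : ∀ i, c i ≤ B) :
    ParityAccepting (fun i => c i + 1) ↔ ¬ ParityAccepting c := by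
  obtain ⟨k, hk, hk'⟩ := exists_limsup_of_bounded hB
  have h1 : ∃ᶠ i in atTop, c i + 1 = k + 1 := hk.mono fun i hi => by omega
  have h2 : ∀ᶠ i in atTop, c i + 1 ≤ k + 1 := hk'.mono fun i hi => by omega
  refine ⟨fun h h' => ?_, fun h => ⟨k + 1, ?_, h1, h2⟩⟩
  · have := h.eq_limsup h1 h2
    have := h'.eq_limsup hk hk'
    grind
  · by_contra h3
    exact h ⟨k, by grind, hk, hk'⟩

/-! ### Tracks, cuts and the language. -/

/-- The letters: `none` cuts the track at position `0`, the other letters permute the tracks. -/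
abbrev Letter : Type := Option Bool

/-- The positions of the tracks. -/
abbrev Track (n : ℕ) : Type := Fin (2 * n + 2)

/-- The permutation of the positions by a letter. -/
def letterPerm (n : ℕ) : Letter → Equiv.Perm (Track n)
  | none => 1
  | some true => Equiv.swap 0 1
  | some false => finRotate _

/-- The permutation of the positions by a finite word. -/
def wordPerm (n : ℕ) : List Letter → Equiv.Perm (Track n)
  | [] => 1
  | a :: x => wordPerm n x * letterPerm n a

theorem wordPerm_append (n : ℕ) (x y : List Letter) :
    wordPerm n (x ++ y) = wordPerm n y * wordPerm n x := by
  induction x with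
  | nil => simp [wordPerm]
  | cons a x ih => simp [wordPerm, ih, mul_assoc]

theorem wordPerm_concat (n : ℕ) (x : List Letter) (a : Letter) :
    wordPerm n (x ++ [a]) = letterPerm n a * wordPerm n x := by
  simp [wordPerm_append, wordPerm]

/-- Every permutation of the positions is induced by a word without cuts. -/
theorem exists_wordPerm_eq (n : ℕ) (p : Equiv.Perm (Track n)) :
    ∃ u : List Letter, none ∉ u ∧ wordPerm n u = p := by
  have hc := Equiv.Perm.closure_cycle_adjacent_swap (isCycle_finRotate (n := 2 * n))
    support_finRotate 0
  have h1 : (finRotate (2 * n + 2)) 0 = 1 := by simp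
  rw [h1] at hc
  -- In a finite group inverses are positive powers, so no letters for the inverse permutations are
  -- needed.
  have hp : p ∈ Submonoid.closure
      ({finRotate (2 * n + 2), Equiv.swap 0 1} : Set (Equiv.Perm (Track n))) := by
    rw [← Subgroup.closure_toSubmonoid_of_finite, hc]
    trivial
  induction hp using Submonoid.closure_induction with
  | mem q hq =>
    rcases hq with rfl | rfl
    · exact ⟨[some false], by simp, by simp [wordPerm, letterPerm]⟩
    · exact ⟨[some true], by simp, by simp [wordPerm, letterPerm]⟩
  | one => exact ⟨[], by simp, rfl⟩
  | mul q r _ _ hq hr =>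
    obtain ⟨u, hu, rfl⟩ := hq
    obtain ⟨v, hv, rfl⟩ := hr
    exact ⟨v ++ u, by simp [hu, hv], wordPerm_append _ _ _⟩

/-- The track that starts at position `i` is cut in round `t`. -/
def CutAt (n : ℕ) (w : ℕ → Letter) (i : Track n) (t : ℕ) : Prop :=
  w t = none ∧ wordPerm n (wordPrefix w t) i = 0

/-- Every track is cut infinitely often. -/
def CutsAll (n : ℕ) (w : ℕ → Letter) : Prop := ∀ i : Track n, ∃ᶠ t in atTop, CutAt n w i t

/-- Words that start with the swap and leave some track uncut from some time on, and words that
start with another letter and cut every track infinitely often. -/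
def trackLanguage (n : ℕ) : Set (ℕ → Letter) := {w | w 0 = some true ↔ ¬ CutsAll n w}

/-! ### The small alternating automaton and the round-robin strategy. -/

namespace PosFormula

variable {Q : Type}

/-- Disjunction or conjunction. -/
def conn : Bool → PosFormula Q → PosFormula Q → PosFormula Q
  | true => or
  | false => and

/-- The disjunction or conjunction of the atoms `f s, …, f (s + k)`. -/
def choice (e : Bool) (f : ℕ → Q) : ℕ → ℕ → PosFormula Q
  | 0, s => atom (f s)
  | k + 1, s => conn e (atom (f s)) (choice e f k (s + 1))

theorem length_choice (e : Bool) (f : ℕ → Q) (k s : ℕ) : (choice e f k s).length = 2 * k + 1 := by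
  induction k generalizing s with
  | zero => rfl
  | succ k ih => cases e <;> simp only [choice, conn, length, ih] <;> ring

theorem follow_conn (e : Bool) (φ ψ : PosFormula Q) (b : Bool) (u : List Bool) :
    (conn e φ ψ).follow (b :: u) = if b then ψ.follow u else φ.follow u := by
  cases e <;> rfl

theorem exists_of_follow_choice {e : Bool} {f : ℕ → Q} {k s : ℕ} {b : List Bool} {q : Q}
    (h : (choice e f k s).follow b = some (atom q)) : ∃ j, q = f j := by
  induction k generalizing s b with
  | zero =>
    cases b with
    | nil => simp only [choice, follow, Option.some.injEq, atom.injEq] at h; exact ⟨s, h.symm⟩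
    | cons c b => simp [choice, follow] at h
  | succ k ih =>
    cases b with
    | nil => cases e <;> simp [choice, conn, follow] at h
    | cons c b =>
      rw [choice, follow_conn] at h
      cases c
      · cases b with
        | nil => simp [follow] at h; exact ⟨s, h.symm⟩
        | cons c b => simp [follow] at h
      · exact ih (by simpa using h)

/-- Counting down to the atom with number `t` leads to that atom. -/
theorem follow_choice_eq {e : Bool} {f : ℕ → Q} {k s t : ℕ} {b : List Bool} {q : Q}
    (h : (choice e f k s).follow b = some (atom q)) (hst : s ≤ t) (htk : t ≤ s + k)
    (hb : ∀ u c v φ₁ φ₂, b = u ++ c :: v → (choice e f k s).follow u = some (conn e φ₁ φ₂) →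
      c = decide (s + u.length < t)) : q = f t := by
  induction k generalizing s b with
  | zero =>
    obtain rfl : s = t := by omega
    cases b with
    | nil => simp only [choice, follow, Option.some.injEq, atom.injEq] at h; exact h.symm
    | cons c b => simp [choice, follow] at h
  | succ k ih =>
    cases b with
    | nil => cases e <;> simp [choice, conn, follow] at h
    | cons c b =>
      have hc := hb [] c b (atom (f s)) (choice e f k (s + 1)) rfl (by cases e <;> rfl)
      rw [choice, follow_conn] at h
      simp only [List.length_nil, add_zero] at hc
      by_cases hlt : s < t
      · simp only [hlt, decide_true] at hc
        subst hc
        refine ih (by simpa using h) (by omega) (by omega) fun u c v φ₁ φ₂ h1 h2 => ?_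
        have := hb (true :: u) c v φ₁ φ₂ (by simp [h1]) (by simpa [choice, follow_conn] using h2)
        rw [this, List.length_cons]
        congr 2
        ring
      · obtain rfl : s = t := by omega
        simp only [lt_irrefl, decide_false] at hc
        subst hc
        cases b with
        | nil => simp [follow] at h; exact h.symm
        | cons c b => simp [follow] at h

end PosFormula

/-- The side on which a state is, and the position of the track that it follows, when the letter
`a` is read. The initial state `none` starts at position `0` on the side selected by `a`. -/
def trackLoc (n : ℕ) : Option (Bool × Track n) → Letter → Bool × Track n
  | some s, _ => s
  | none, a => (decide (a = some true), 0)

/-- The automaton for `trackLanguage n`. It follows a track; when this is cut, Eve (on the side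
`true`) or Adam (on the side `false`) chooses a new track. -/
abbrev trackAutomaton (n : ℕ) : AltParityAutomaton Letter where
  State := Option (Bool × Track n)
  init := none
  δ s a :=
    if a = none ∧ (trackLoc n s a).2 = 0 then
      .choice (trackLoc n s a).1 (fun j => some ((trackLoc n s a).1, Fin.ofNat _ j)) (2 * n + 1) 0
    else .atom (some ((trackLoc n s a).1, letterPerm n a (trackLoc n s a).2))
  priorities := {0, 1, 2}
  priority s a _ :=
    if a = none ∧ (trackLoc n s a).2 = 0 then (if (trackLoc n s a).1 then 1 else 2)
    else (if (trackLoc n s a).1 then 0 else 1)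
  priority_mem s a _ := by split_ifs <;> simp

/-- The configuration of the round-robin strategy: the permutation of the positions so far, and
the number of times that the followed track has been cut. -/
def roundRobin (n : ℕ) (x : List Letter) : Equiv.Perm (Track n) × ℕ :=
  x.foldl (fun s a => (letterPerm n a * s.1,
    if a = none ∧ s.1 (Fin.ofNat _ s.2) = 0 then s.2 + 1 else s.2)) (1, 0)

/-- The position of the track followed by the round-robin strategy. -/
def roundRobinPos (n : ℕ) (x : List Letter) : Track n :=
  (roundRobin n x).1 (Fin.ofNat _ (roundRobin n x).2)

/-- The strategy of either player that chooses the tracks in cyclic order. -/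
def roundRobinStrategy (n : ℕ) : ChoiceStrategy Letter :=
  -- In `choice`, the atom with number `t` is reached by `t` steps to the right and then, unless it
  -- is the last atom, one to the left. The current letter is appended because the new track is
  -- named by its position after this letter.
  fun h a u => decide (u.length < (roundRobinPos n (h.map Prod.fst ++ [a])).val)

theorem roundRobin_concat (n : ℕ) (x : List Letter) (a : Letter) :
    roundRobin n (x ++ [a]) = (letterPerm n a * (roundRobin n x).1,
      if a = none ∧ roundRobinPos n x = 0 then (roundRobin n x).2 + 1 else (roundRobin n x).2) := by
  simp only [roundRobin, roundRobinPos, List.foldl_append, List.foldl_cons, List.foldl_nil]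
  congr

theorem roundRobin_fst (n : ℕ) (x : List Letter) : (roundRobin n x).1 = wordPerm n x := by
  induction x using List.reverseRecOn with
  | nil => rfl
  | append_singleton x a ih => rw [roundRobin_concat, wordPerm_concat, ih]

theorem roundRobinPos_concat {n : ℕ} {x : List Letter} {a : Letter}
    (h : ¬ (a = none ∧ roundRobinPos n x = 0)) :
    roundRobinPos n (x ++ [a]) = letterPerm n a (roundRobinPos n x) := by
  have h' := roundRobin_concat n x a
  rw [if_neg h] at h'
  rw [roundRobinPos, h']
  rfl

/-- A sequence of positions that follows a track as long as it is not cut. -/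
def FollowsTracks (n : ℕ) (w : ℕ → Letter) (pos : ℕ → Track n) : Prop :=
  ∀ i, ¬ (w i = none ∧ pos i = 0) → pos (i + 1) = letterPerm n (w i) (pos i)

/-- Following tracks with finitely many cuts ends on a track that is cut finitely often. -/
theorem FollowsTracks.not_cutsAll {n : ℕ} {w : ℕ → Letter} {pos : ℕ → Track n}
    (h : FollowsTracks n w pos) (hfin : ¬ ∃ᶠ i in atTop, w i = none ∧ pos i = 0) :
    ¬ CutsAll n w := by
  rw [not_frequently, eventually_atTop] at hfin
  obtain ⟨T, hT⟩ := hfin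
  intro hall
  -- After the last cut, the sequence stays on one track, identified by its starting position.
  have key : ∀ t, T ≤ t → pos t =
      wordPerm n (wordPrefix w t) ((wordPerm n (wordPrefix w T))⁻¹ (pos T)) := by
    intro t ht
    induction t, ht using Nat.le_induction with
    | base => simp
    | succ t ht ih =>
      rw [h t (hT t ht), ih, wordPrefix_succ, wordPerm_concat]
      rfl
  obtain ⟨t, ht, hcut⟩ := (frequently_atTop.1 (hall _)) T
  exact hT t ht ⟨hcut.1, (key t ht).trans hcut.2⟩

/-- If some track is cut finitely often, then the round-robin strategy suffers finitely many
cuts. -/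
theorem roundRobin_finite_cuts {n : ℕ} {w : ℕ → Letter} (h : ¬ CutsAll n w) :
    ¬ ∃ᶠ i in atTop, w i = none ∧ roundRobinPos n (wordPrefix w i) = 0 := by
  intro hinf
  simp only [CutsAll, not_forall, not_frequently, eventually_atTop] at h
  obtain ⟨i₀, T, hT⟩ := h
  -- The counter keeps its value until the next cut of the followed track, so with infinitely many
  -- cuts it takes every later value.
  have hstep : ∀ t, ∃ t', t ≤ t' ∧ (roundRobin n (wordPrefix w t')).2 =
      (roundRobin n (wordPrefix w t)).2 ∧ w t' = none ∧
      roundRobinPos n (wordPrefix w t') = 0 := by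
    intro t
    by_contra hno
    push Not at hno
    have hconst : ∀ t', t ≤ t' → (roundRobin n (wordPrefix w t')).2 =
        (roundRobin n (wordPrefix w t)).2 := by
      intro t' ht'
      induction t', ht' using Nat.le_induction with
      | base => rfl
      | succ t' ht' ih =>
        rw [wordPrefix_succ, roundRobin_concat]
        simp only
        rw [if_neg fun h => hno t' ht' ih h.1 h.2, ih]
    obtain ⟨t', ht', h1, h2⟩ := (frequently_atTop.1 hinf) t
    exact hno t' ht' (hconst t' ht') h1 h2
  have hreach : ∀ K, (roundRobin n (wordPrefix w T)).2 ≤ K →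
      ∃ t, T ≤ t ∧ (roundRobin n (wordPrefix w t)).2 = K := by
    intro K hK
    induction K, hK using Nat.le_induction with
    | base => exact ⟨T, le_rfl, rfl⟩
    | succ K _ ih =>
      obtain ⟨t, ht, rfl⟩ := ih
      obtain ⟨t', ht', h1, h2, h3⟩ := hstep t
      refine ⟨t' + 1, by omega, ?_⟩
      rw [wordPrefix_succ, roundRobin_concat]
      simp only
      rw [if_pos ⟨h2, h3⟩, h1]
  -- This value is at least the counter at time `T` and is congruent to `i₀` modulo the number of
  -- tracks: the strategy then follows the track `i₀`, which is no longer cut.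
  obtain ⟨t, ht, hk⟩ := hreach
    ((roundRobin n (wordPrefix w T)).2 * (2 * n + 2) + i₀.val) (by nlinarith)
  obtain ⟨t', ht', h1, h2, h3⟩ := hstep t
  refine hT t' (by omega) ⟨h2, ?_⟩
  have hi : Fin.ofNat (2 * n + 2) (roundRobin n (wordPrefix w t')).2 = i₀ := by
    rw [h1, hk]
    ext
    simp [Fin.ofNat, Nat.mod_eq_of_lt i₀.isLt]
  rw [roundRobinPos, hi, roundRobin_fst] at h3
  exact h3

section

variable {n : ℕ} {w : ℕ → Letter} (ρ : (trackAutomaton n).Play w)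

theorem trackAutomaton_step (i : ℕ) :
    (ρ.state (i + 1)) = some ((trackLoc n (ρ.state i) (w i)).1,
      (trackLoc n (ρ.state (i + 1)) (w (i + 1))).2) ∧
    (¬ (w i = none ∧ (trackLoc n (ρ.state i) (w i)).2 = 0) →
      (trackLoc n (ρ.state (i + 1)) (w (i + 1))).2 =
        letterPerm n (w i) (trackLoc n (ρ.state i) (w i)).2) := by
  have h := ρ.step i
  by_cases hit : w i = none ∧ (trackLoc n (ρ.state i) (w i)).2 = 0
  · have hδ : (trackAutomaton n).δ (ρ.state i) (w i) = _ := if_pos hit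
    rw [hδ] at h
    obtain ⟨j, hj⟩ := PosFormula.exists_of_follow_choice h
    rw [hj]
    exact ⟨rfl, fun h => absurd hit h⟩
  · have hδ : (trackAutomaton n).δ (ρ.state i) (w i) = _ := if_neg hit
    rw [hδ] at h
    cases hb : ρ.branch i with
    | cons _ _ => simp [hb, PosFormula.follow] at h
    | nil =>
      rw [hb] at h
      obtain h := PosFormula.atom.inj (Option.some.inj h)
      rw [← h]
      exact ⟨rfl, fun _ => rfl⟩

theorem trackAutomaton_side (i : ℕ) :
    (trackLoc n (ρ.state i) (w i)).1 = decide (w 0 = some true) := by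
  induction i with
  | zero => rw [ρ.state_zero]; rfl
  | succ i ih => rw [(trackAutomaton_step ρ i).1, ← ih]; rfl

/-- A cut has priority 1 against 0 on Eve's side, and 2 against 1 on Adam's side. -/
theorem trackAutomaton_isAccepting_iff : ρ.IsAccepting ↔
    (w 0 = some true ↔
      ¬ ∃ᶠ i in atTop, w i = none ∧ (trackLoc n (ρ.state i) (w i)).2 = 0) := by
  have hp : ∀ i, (trackAutomaton n).priority (ρ.state i) (w i) (ρ.state (i + 1)) =
      if w i = none ∧ (trackLoc n (ρ.state i) (w i)).2 = 0 then
        (if w 0 = some true then 1 else 2) else (if w 0 = some true then 0 else 1) := by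
    intro i
    simp only [trackAutomaton]
    rw [trackAutomaton_side]
    simp
  have hacc : ρ.IsAccepting ↔ ParityAccepting fun i =>
      if w i = none ∧ (trackLoc n (ρ.state i) (w i)).2 = 0 then
        (if w 0 = some true then 1 else 2) else (if w 0 = some true then 0 else 1) :=
    iff_of_eq (congrArg ParityAccepting (funext hp))
  rw [hacc]
  by_cases h0 : w 0 = some true
  · simp only [h0, if_true, true_iff]
    refine ⟨fun h hf => ?_, fun h => ⟨0, by simp, ?_, ?_⟩⟩
    · have := h.eq_limsup (k := 1) (hf.mono fun i hi => if_pos hi)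
        (Eventually.of_forall fun i => by split_ifs <;> simp)
      simp at this
    · rw [not_frequently] at h
      exact (h.mono fun i hi => if_neg hi).frequently
    · rw [not_frequently] at h
      exact h.mono fun i hi => (if_neg hi).le
  · simp only [h0, if_false, false_iff, not_not]
    refine ⟨fun h => ?_, fun h => ⟨2, by simp, ?_, ?_⟩⟩
    · by_contra hf
      rw [not_frequently] at hf
      have := h.eq_limsup (k := 1) (hf.mono fun i hi => if_neg hi).frequently
        (hf.mono fun i hi => (if_neg hi).le)
      simp at this
    · exact h.mono fun i hi => if_pos hi
    · exact Eventually.of_forall fun i => by dsimp only; split_ifs <;> simp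

theorem trackAutomaton_followsTracks :
    FollowsTracks n w fun i => (trackLoc n (ρ.state i) (w i)).2 :=
  fun i hi => (trackAutomaton_step ρ i).2 hi

/-- If the player who chooses the tracks uses the round-robin strategy, then the followed tracks
are those of that strategy. -/
theorem trackAutomaton_roundRobin
    (hρ : ∀ (i : ℕ) (u : List Bool) (b : Bool) (v : List Bool)
      (φ₁ φ₂ : PosFormula (Option (Bool × Track n))), ρ.branch i = u ++ b :: v →
      ((trackAutomaton n).δ (ρ.state i) (w i)).follow u =
        some (PosFormula.conn (decide (w 0 = some true)) φ₁ φ₂) →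
      b = roundRobinStrategy n (ρ.history i) (w i) u) (i : ℕ) :
    (trackLoc n (ρ.state i) (w i)).2 = roundRobinPos n (wordPrefix w i) := by
  induction i with
  | zero => rw [ρ.state_zero]; rfl
  | succ i ih =>
    by_cases hit : w i = none ∧ (trackLoc n (ρ.state i) (w i)).2 = 0
    · have hδ : (trackAutomaton n).δ (ρ.state i) (w i) = _ := if_pos hit
      have h1 := ρ.step i
      have h2 := hρ i
      rw [hδ] at h1 h2
      have := PosFormula.follow_choice_eq (t := (roundRobinPos n (wordPrefix w (i + 1))).val) h1
        (Nat.zero_le _) (by omega) fun u c v φ₁ φ₂ hb hu => ?_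
      · rw [this]
        simp [trackLoc, Fin.ofNat_eq_cast]
      · rw [trackAutomaton_side] at hu h2
        rw [h2 u c v φ₁ φ₂ hb hu, roundRobinStrategy, ρ.history_map_fst, wordPrefix_succ, zero_add]
    · rw [(trackAutomaton_step ρ i).2 hit, ih, wordPrefix_succ, roundRobinPos_concat]
      rwa [← ih]

end

/-- On each side only one player has choices. Round-robin is that player's winning strategy when
some track is cut finitely often; otherwise `FollowsTracks.not_cutsAll` shows that all choices fail,
so the opponent wins without choosing. -/
theorem trackAutomaton_isGFG_and_language (n : ℕ) :
    (trackAutomaton n).IsGFG ∧ (trackAutomaton n).language = trackLanguage n := by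
  refine AltParityAutomaton.isGFG_and_language_eq (σ := roundRobinStrategy n)
    (τ := roundRobinStrategy n) (fun w hw ρ hρ => ?_) (fun w hw ρ hρ => ?_)
  · rw [trackAutomaton_isAccepting_iff]
    rw [trackLanguage, Set.mem_ofPred_eq] at hw
    by_cases h0 : w 0 = some true
    · have hc := hw.1 h0
      have h := roundRobin_finite_cuts hc
      simp_rw [← trackAutomaton_roundRobin ρ fun i u b v φ₁ φ₂ hb hu =>
        hρ i u b v _ hb hu ⟨φ₁, φ₂, by simp only [h0, decide_true]; rfl⟩] at h
      exact iff_of_true h0 h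
    · refine iff_of_false h0 fun h => h0 (hw.2 ?_)
      exact (trackAutomaton_followsTracks ρ).not_cutsAll h
  · rw [trackAutomaton_isAccepting_iff]
    rw [trackLanguage, Set.mem_ofPred_eq] at hw
    intro hacc
    by_cases h0 : w 0 = some true
    · exact hw (iff_of_true h0 ((trackAutomaton_followsTracks ρ).not_cutsAll (hacc.1 h0)))
    · have hc : ¬ CutsAll n w := fun hc => hw (iff_of_false h0 (not_not.2 hc))
      have h := roundRobin_finite_cuts hc
      simp_rw [← trackAutomaton_roundRobin ρ fun i u b v φ₁ φ₂ hb hu =>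
        hρ i u b v _ hb hu ⟨φ₁, φ₂, by simp only [h0, decide_false]; rfl⟩] at h
      exact h0 (hacc.2 h)

/-- The sum of lengths dominates: `4n+5` states and three letters contribute one each, and only
three states (position `0` on either side, and the initial state) have a further `4n+2`, over the
letter `none`. -/
theorem trackAutomaton_size_le (n : ℕ) : (trackAutomaton n).size ≤ 24 * n + 21 := by
  have hlen : ∀ (s : Option (Bool × Track n)) (a : Letter),
      ((trackAutomaton n).δ s a).length ≤
        1 + if a = none ∧ (trackLoc n s a).2 = 0 then 4 * n + 2 else 0 := by
    intro s a
    simp only [trackAutomaton]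
    split_ifs with h
    · rw [PosFormula.length_choice]; omega
    · simp [PosFormula.length]
  have hsum : ∑ s : Option (Bool × Track n), ∑ a : Letter,
      ((trackAutomaton n).δ s a).length ≤ 24 * n + 21 := by
    refine (Finset.sum_le_sum fun s _ => Finset.sum_le_sum fun a _ => hlen s a).trans ?_
    simp only [Finset.sum_add_distrib, Fintype.sum_option, Fintype.sum_prod_type, Fintype.sum_bool,
      trackLoc]
    simp
    omega
  have hcard : Fintype.card (Option (Bool × Track n)) = 4 * n + 5 := by
    simp; omega
  simp only [AltParityAutomaton.size]
  refine max_le (by simp) (max_le ?_ (max_le ?_ ?_))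
  · exact (show _ = _ from hcard).le.trans (by omega)
  · exact hsum
  · exact (show _ ≤ 3 from Finset.card_le_three).trans (by omega)

theorem le_trackAutomaton_size (n : ℕ) : n ≤ (trackAutomaton n).size := by
  have hcard : Fintype.card (Option (Bool × Track n)) = 4 * n + 5 := by
    simp; omega
  simp only [AltParityAutomaton.size]
  refine le_max_of_le_right (le_max_of_le_left ?_)
  exact (show n ≤ 4 * n + 5 by omega).trans (show _ = _ from hcard).ge

/-! ### Infinite words as limits, and repetition of closed walks. -/

section Sequences

variable {X : Type}

/-- The sequence with first entry `a` that continues as `b`. -/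
def consSeq (a : X) (b : ℕ → X) : ℕ → X
  | 0 => a
  | t + 1 => b t

/-- The sequence that starts with a list and continues as `b`. -/
def catSeq : List X → (ℕ → X) → ℕ → X
  | [], b => b
  | a :: y, b => consSeq a (catSeq y b)

theorem catSeq_concat (y : List X) (a : X) (b : ℕ → X) :
    catSeq (y ++ [a]) b = catSeq y (consSeq a b) := by
  induction y with
  | nil => rfl
  | cons c y ih => simp only [List.cons_append, catSeq, ih]

theorem catSeq_add (y : List X) (b : ℕ → X) (t : ℕ) : catSeq y b (y.length + t) = b t := by
  induction y with
  | nil => simp [catSeq]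
  | cons c y ih =>
    rw [List.length_cons, show y.length + 1 + t = (y.length + t) + 1 by ring]
    exact ih

theorem wordPrefix_consSeq (a : X) (b : ℕ → X) (t : ℕ) :
    wordPrefix (consSeq a b) (t + 1) = a :: wordPrefix b t := by
  simp [wordPrefix, List.range_succ_eq_map, consSeq, Function.comp_def]

theorem wordPrefix_catSeq (y : List X) (b : ℕ → X) (t : ℕ) :
    wordPrefix (catSeq y b) (y.length + t) = y ++ wordPrefix b t := by
  induction y with
  | nil => simp [catSeq]
  | cons c y ih =>
    rw [List.length_cons, show y.length + 1 + t = (y.length + t) + 1 by ring, catSeq,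
      wordPrefix_consSeq, ih, List.cons_append]

theorem exists_wordPrefix_eq (w : ℕ → X) {t L : ℕ} (h : t < L) :
    ∃ r, wordPrefix w L = wordPrefix w t ++ w t :: r := by
  induction L, h using Nat.le_induction with
  | base => exact ⟨[], wordPrefix_succ w t⟩
  | succ L _ ih =>
    obtain ⟨r, hr⟩ := ih
    exact ⟨r ++ [w L], by rw [wordPrefix_succ, hr]; simp⟩

theorem wordPrefix_eq_of_append {w : ℕ → X} {L : ℕ} {x r : List X} {a : X}
    (h : wordPrefix w L = x ++ a :: r) : wordPrefix w x.length = x ∧ w x.length = a := by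
  have hL : x.length < L := by
    have := congrArg List.length h
    simp [length_wordPrefix] at this
    omega
  obtain ⟨r', hr'⟩ := exists_wordPrefix_eq w hL
  rw [hr'] at h
  have := List.append_inj h (length_wordPrefix _ _)
  exact ⟨this.1, (List.cons.inj this.2).1⟩

/-- An increasing chain of finite words converges to an infinite word. -/
theorem exists_limit_word [Inhabited X] {y : ℕ → List X}
    (h : ∀ k, ∃ z, z ≠ [] ∧ y (k + 1) = y k ++ z) :
    (∀ k, k ≤ (y k).length) ∧ ∃ w, ∀ k, wordPrefix w (y k).length = y k := by
  have hpre : ∀ k l, k ≤ l → y k <+: y l := by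
    intro k l hkl
    induction l, hkl using Nat.le_induction with
    | base => exact List.prefix_rfl
    | succ l _ ih =>
      obtain ⟨z, -, hz⟩ := h l
      exact ih.trans ⟨z, hz.symm⟩
  have hlen : ∀ k, k ≤ (y k).length := by
    intro k
    induction k with
    | zero => simp
    | succ k ih =>
      obtain ⟨z, hz0, hz⟩ := h k
      have := List.length_pos_iff.2 hz0
      rw [hz, List.length_append]
      omega
  refine ⟨hlen, fun i => (y (i + 1)).getD i default, fun k => ?_⟩
  refine List.ext_getElem (length_wordPrefix _ _) fun j h1 h2 => ?_
  have h3 : j < (y (j + 1)).length := hlen (j + 1)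
  simp only [wordPrefix, List.getElem_map, List.getElem_range]
  rw [List.getD_eq_getElem _ _ h3]
  rcases le_total (j + 1) k with hk | hk
  · exact (hpre _ _ hk).getElem h3
  · exact ((hpre _ _ hk).getElem h2).symm

theorem ParityAccepting.of_shift {c : ℕ → ℕ} (h : ParityAccepting fun i => c (i + 1)) :
    ParityAccepting c := by
  obtain ⟨k, hk, h1, h2⟩ := h
  refine ⟨k, hk, ?_, ?_⟩
  · rw [← map_add_atTop_eq_nat 1]; exact h1
  · rw [← map_add_atTop_eq_nat 1]; exact h2

/-- There is a path of the given length to `z`. -/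
def ReachIn (R : X → X → Prop) (z : X) : ℕ → X → Prop
  | 0, y => y = z
  | k + 1, y => ∃ y', R y y' ∧ ReachIn R z k y'

theorem exists_reachIn {R : X → X → Prop} {y z : X} (h : Relation.ReflTransGen R y z) :
    ∃ k, ReachIn R z k y := by
  induction h using Relation.ReflTransGen.head_induction_on with
  | refl => exact ⟨0, rfl⟩
  | head h _ ih =>
    obtain ⟨k, hk⟩ := ih
    exact ⟨k + 1, _, h, hk⟩

/-- A closed walk can be repeated forever. -/
theorem exists_seq_of_cycle {R T : X → X → Prop} (hTR : ∀ x y, T x y → R x y) {x x₁ x₂ : X}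
    (h₁ : Relation.ReflTransGen R x x₁) (h : T x₁ x₂) (h₂ : Relation.ReflTransGen R x₂ x) :
    ∃ f : ℕ → X, f 0 = x ∧ (∀ j, R (f j) (f (j + 1))) ∧ ∃ᶠ j in atTop, T (f j) (f (j + 1)) := by
  obtain ⟨k₀, hk₀⟩ := exists_reachIn h₁
  obtain ⟨k₁, hk₁⟩ := exists_reachIn (h₂.trans h₁)
  -- Each vertex carries a countdown to `x₁`; at zero the step `T` is taken and the countdown
  -- restarts with `k₁`.
  have hnext : ∀ s : {p : ℕ × X // ReachIn R x₁ p.1 p.2},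
      ∃ s' : {p : ℕ × X // ReachIn R x₁ p.1 p.2}, R s.1.2 s'.1.2 ∧
        (s.1.1 = 0 → T s.1.2 s'.1.2) ∧ (s.1.1 ≠ 0 → s'.1.1 + 1 = s.1.1) := by
    rintro ⟨⟨k, y⟩, hy⟩
    cases k with
    | zero =>
      obtain rfl : y = x₁ := hy
      exact ⟨⟨(k₁, x₂), hk₁⟩, hTR _ _ h, fun _ => h, fun h => absurd rfl h⟩
    | succ k =>
      obtain ⟨y', hR, hy'⟩ := hy
      exact ⟨⟨(k, y'), hy'⟩, hR, fun h => absurd h (Nat.succ_ne_zero k), fun _ => rfl⟩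
  choose next hR hT hdec using hnext
  let g : ℕ → {p : ℕ × X // ReachIn R x₁ p.1 p.2} := fun j => next^[j] ⟨(k₀, x), hk₀⟩
  have hg : ∀ j, g (j + 1) = next (g j) := fun j => Function.iterate_succ_apply' _ _ _
  refine ⟨fun j => (g j).1.2, rfl, fun j => by simpa only [hg] using hR _, ?_⟩
  have hzero : ∀ k j, (g j).1.1 = k → ∃ j', j ≤ j' ∧ (g j').1.1 = 0 := by
    intro k
    induction k with
    | zero => exact fun j hj => ⟨j, le_rfl, hj⟩
    | succ k ih =>
      intro j hj
      have := hdec (g j) (by omega)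
      rw [← hg] at this
      obtain ⟨j', hj', h0⟩ := ih (j + 1) (by omega)
      exact ⟨j', by omega, h0⟩
  refine frequently_atTop.2 fun j => ?_
  obtain ⟨j', hj', h0⟩ := hzero _ j rfl
  exact ⟨j', hj', by simpa only [hg] using hT _ h0⟩

end Sequences

/-! ### The common setting of the two lower bounds. -/

/-- A parity condition on a transition relation, together with a way to run on finite words such
that: accepting paths exist only on words in the set `words`; the run on every word of that set is
accepting; and for words that start with `first`, the set consists of those that cut every track
infinitely often. -/
structure TrackRun (n : ℕ) (Q : Type) where
  trans : Q → Letter → Q → Prop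
  prio : Q → Letter → Q → ℕ
  bound : ℕ
  prio_le : ∀ q a q', prio q a q' ≤ bound
  run : List Letter → Q
  trans_run : ∀ x a, trans (run x) a (run (x ++ [a]))
  words : Set (ℕ → Letter)
  first : Letter
  mem_words_iff : ∀ w : ℕ → Letter, w 0 = first → (w ∈ words ↔ CutsAll n w)
  sound : ∀ (w : ℕ → Letter) (s : ℕ → Q), s 0 = run [] → (∀ i, trans (s i) (w i) (s (i + 1))) →
    ParityAccepting (fun i => prio (s i) (w i) (s (i + 1))) → w ∈ words
  complete : ∀ w ∈ words, ParityAccepting fun i =>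
    prio (run (wordPrefix w i)) (w i) (run (wordPrefix w (i + 1)))

/-- The track at position `i` is not cut by the word. -/
def Uncut (n : ℕ) : Track n → List Letter → Prop
  | _, [] => True
  | i, a :: z => ¬ (a = none ∧ i = 0) ∧ Uncut n (letterPerm n a i) z

theorem uncut_of_notMem {n : ℕ} {z : List Letter} (h : none ∉ z) (i : Track n) : Uncut n i z := by
  induction z generalizing i with
  | nil => trivial
  | cons a z ih =>
    rw [List.mem_cons, not_or] at h
    exact ⟨fun h' => h.1 h'.1.symm, ih h.2 _⟩

/-- Only the track that stands at position `0` at the single cut is lost. -/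
theorem exists_uncut {n : ℕ} {z : List Letter} (h : z.count none ≤ 1) :
    ∃ i₀ : Track n, ∀ i, i ≠ i₀ → Uncut n i z := by
  induction z with
  | nil => exact ⟨0, fun _ _ => trivial⟩
  | cons a z ih =>
    by_cases ha : a = none
    · subst ha
      rw [List.count_cons_self] at h
      have h0 : none ∉ z := List.count_eq_zero.1 (by omega)
      exact ⟨0, fun i hi => ⟨fun h' => hi h'.2, uncut_of_notMem h0 _⟩⟩
    · rw [List.count_cons_of_ne ha] at h
      obtain ⟨i₀, hi₀⟩ := ih h
      refine ⟨(letterPerm n a)⁻¹ i₀, fun i hi => ⟨fun h' => ha h'.1, hi₀ _ fun h' => hi ?_⟩⟩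
      rw [← h']
      simp

namespace TrackRun

variable {n : ℕ} {Q : Type} (R : TrackRun n Q)

/-- An accepting path from a state of the run proves membership of the whole word. -/
theorem catSeq_mem_words (y : List Letter) {b : ℕ → Letter} {s : ℕ → Q} (h0 : s 0 = R.run y)
    (hs : ∀ i, R.trans (s i) (b i) (s (i + 1)))
    (hacc : ParityAccepting fun i => R.prio (s i) (b i) (s (i + 1))) : catSeq y b ∈ R.words := by
  induction y using List.reverseRecOn generalizing b s with
  | nil => exact R.sound b s h0 hs hacc
  | append_singleton y a ih =>
    rw [catSeq_concat]
    refine ih (s := consSeq (R.run y) s) rfl (fun i => ?_) (ParityAccepting.of_shift hacc)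
    cases i with
    | zero =>
      have := R.trans_run y a
      rw [← h0] at this
      exact this
    | succ i => exact hs i

/-! ### Walks along uncut tracks and their ranks. -/

/-- A transition of priority at most `P` that keeps a track uncut. -/
def Move (P : ℕ) (x y : Q × Track n) : Prop :=
  ∃ a, R.trans x.1 a y.1 ∧ ¬ (a = none ∧ x.2 = 0) ∧ y.2 = letterPerm n a x.2 ∧
    R.prio x.1 a y.1 ≤ P

/-- A transition of priority `P` that keeps a track uncut. -/
def TopMove (P : ℕ) (x y : Q × Track n) : Prop :=
  ∃ a, R.trans x.1 a y.1 ∧ ¬ (a = none ∧ x.2 = 0) ∧ y.2 = letterPerm n a x.2 ∧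
    R.prio x.1 a y.1 = P

theorem TopMove.move {R : TrackRun n Q} {P : ℕ} {x y : Q × Track n} (h : R.TopMove P x y) :
    R.Move P x y := by
  obtain ⟨a, h1, h2, h3, h4⟩ := h
  exact ⟨a, h1, h2, h3, h4.le⟩

/-- `y` can be reached from `x` with priorities at most `P`, attaining `P`, on an uncut track. -/
def Descends (P : ℕ) (x y : Q × Track n) : Prop :=
  ∃ x₁ x₂, Relation.ReflTransGen (R.Move P) x x₁ ∧ R.TopMove P x₁ x₂ ∧
    Relation.ReflTransGen (R.Move P) x₂ y

variable {R}

theorem Descends.trans {P : ℕ} {x y z : Q × Track n} (h : R.Descends P x y)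
    (h' : R.Descends P y z) : R.Descends P x z := by
  obtain ⟨x₁, x₂, h1, h2, h3⟩ := h
  obtain ⟨y₁, y₂, h1', h2', h3'⟩ := h'
  exact ⟨x₁, x₂, h1, h2, h3.trans (h1'.trans (.head h2'.move h3'))⟩

theorem Descends.head {P : ℕ} {x y z : Q × Track n}
    (h : Relation.ReflTransGen (R.Move P) x y) (h' : R.Descends P y z) : R.Descends P x z := by
  obtain ⟨x₁, x₂, h1, h2, h3⟩ := h'
  exact ⟨x₁, x₂, h.trans h1, h2, h3⟩

/-- Repeating the cycle forever gives a path with limit priority `P`, hence accepting, on a word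
that never again cuts the followed track. This contradicts soundness. The path need not be the run,
so soundness is needed for all paths. -/
theorem not_descends_self {P : ℕ} (hP : Even P) {y : List Letter}
    (hy : y.head? = some R.first) (i : Track n) : ¬ R.Descends P (R.run y, i) (R.run y, i) := by
  rintro ⟨x₁, x₂, h1, h2, h3⟩
  obtain ⟨f, hf0, hf, hfreq⟩ := exists_seq_of_cycle (fun _ _ => TopMove.move) h1 h2 h3
  -- Different letters may realise the same move with different priorities; where a top move exists,
  -- its own letter is taken.
  have hletter : ∀ j, ∃ a, R.trans (f j).1 a (f (j + 1)).1 ∧ ¬ (a = none ∧ (f j).2 = 0) ∧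
      (f (j + 1)).2 = letterPerm n a (f j).2 ∧ R.prio (f j).1 a (f (j + 1)).1 ≤ P ∧
      (R.TopMove P (f j) (f (j + 1)) → R.prio (f j).1 a (f (j + 1)).1 = P) := by
    intro j
    by_cases hT : R.TopMove P (f j) (f (j + 1))
    · obtain ⟨a, h1, h2, h3, h4⟩ := hT
      exact ⟨a, h1, h2, h3, h4.le, fun _ => h4⟩
    · obtain ⟨a, h1, h2, h3, h4⟩ := hf j
      exact ⟨a, h1, h2, h3, h4, fun h => absurd h hT⟩
  choose b hb1 hb2 hb3 hb4 hb5 using hletter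
  have hw : catSeq y b ∈ R.words := R.catSeq_mem_words y (s := fun j => (f j).1)
    (by rw [hf0]) hb1 ⟨P, hP, hfreq.mono hb5, Eventually.of_forall hb4⟩
  have hw0 : catSeq y b 0 = R.first := by
    cases y with
    | nil => simp at hy
    | cons a y => simp only [List.head?_cons, Option.some.injEq] at hy; exact hy
  have hpos : ∀ t, wordPerm n (wordPrefix b t) i = (f t).2 := by
    intro t
    induction t with
    | zero => rw [hf0]; rfl
    | succ t ih => rw [wordPrefix_succ, wordPerm_concat, hb3, ← ih]; rfl
  -- `CutsAll` names tracks by their starting positions, so the track at `i` after `y` is pulled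
  -- back along `y`.
  obtain ⟨t, ht, hcut1, hcut2⟩ := frequently_atTop.1
    ((R.mem_words_iff _ hw0).1 hw ((wordPerm n y)⁻¹ i)) y.length
  obtain ⟨t, rfl⟩ := Nat.exists_eq_add_of_le ht
  rw [catSeq_add] at hcut1
  rw [wordPrefix_catSeq, wordPerm_append, Equiv.Perm.mul_apply] at hcut2
  simp only [Equiv.Perm.inv_def, Equiv.apply_symm_apply, hpos] at hcut2
  exact hb2 t ⟨hcut1, hcut2⟩

variable (R)

/-- The number of vertices to which a vertex descends. -/
noncomputable def rank (P : ℕ) (x : Q × Track n) : ℕ := {y | R.Descends P x y}.ncard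

variable {R}

theorem rank_le [Finite Q] {P : ℕ} {x y : Q × Track n}
    (h : Relation.ReflTransGen (R.Move P) x y) : R.rank P y ≤ R.rank P x :=
  Set.ncard_le_ncard (fun _ hz => Descends.head h hz) (Set.toFinite _)

/-- The vertex `y` itself is counted for `x` but not for `y`. -/
theorem rank_lt [Finite Q] {P : ℕ} {x y : Q × Track n} (h : R.Descends P x y)
    (hy : ¬ R.Descends P y y) : R.rank P y < R.rank P x :=
  Set.ncard_lt_ncard ⟨fun _ hz => h.trans hz, fun h' => hy (h' h)⟩ (Set.toFinite _)

variable (R)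

/-- The priority that the run meets when it reads `a` after `y`. -/
def prioAt (y : List Letter) (a : Letter) : ℕ := R.prio (R.run y) a (R.run (y ++ [a]))

/-- All priorities that the run meets when it reads `z` after `y` are less than `p`. -/
def Below (p : ℕ) (y z : List Letter) : Prop :=
  ∀ s a s', z = s ++ a :: s' → R.prioAt (y ++ s) a < p

variable {R}

theorem below_cons {p : ℕ} {y z : List Letter} {a : Letter} :
    R.Below p y (a :: z) ↔ R.prioAt y a < p ∧ R.Below p (y ++ [a]) z := by
  refine ⟨fun h => ⟨by simpa using h [] a z rfl, fun s b s' hz => ?_⟩, fun h s b s' hz => ?_⟩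
  · simpa using h (a :: s) b s' (by simp [hz])
  · cases s with
    | nil =>
      simp only [List.nil_append, List.cons.injEq] at hz
      simpa [hz.1] using h.1
    | cons d s =>
      simp only [List.cons_append, List.cons.injEq] at hz
      simpa [hz.1] using h.2 s b s' hz.2

theorem below_append {p : ℕ} {y z z' : List Letter} :
    R.Below p y (z ++ z') ↔ R.Below p y z ∧ R.Below p (y ++ z) z' := by
  induction z generalizing y with
  | nil => simp [Below]
  | cons a z ih => simp [below_cons, ih, and_assoc]

/-- The run on a word that keeps a track uncut is a walk. -/
theorem walk_of_uncut {P : ℕ} {y z : List Letter} {i : Track n} (hz : R.Below (P + 1) y z)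
    (hi : Uncut n i z) :
    Relation.ReflTransGen (R.Move P) (R.run y, i) (R.run (y ++ z), wordPerm n z i) := by
  induction z generalizing y i with
  | nil => simpa [wordPerm] using Relation.ReflTransGen.refl
  | cons a z ih =>
    rw [below_cons] at hz
    have h := ih hz.2 hi.2
    rw [List.append_assoc] at h
    exact .head (b := (R.run (y ++ [a]), letterPerm n a i))
      ⟨a, R.trans_run y a, hi.1, rfl, Nat.le_of_lt_succ hz.1⟩ h

theorem descends_of_uncut {P : ℕ} {y z : List Letter} {i : Track n} (hz : R.Below (P + 1) y z)
    (hi : Uncut n i z) (htop : ¬ R.Below P y z) :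
    R.Descends P (R.run y, i) (R.run (y ++ z), wordPerm n z i) := by
  induction z generalizing y i with
  | nil => exact absurd (fun s a s' h => by simp at h) htop
  | cons a z ih =>
    rw [below_cons] at hz htop
    by_cases ha : R.prioAt y a < P
    · have h := ih hz.2 hi.2 fun h => htop ⟨ha, h⟩
      rw [List.append_assoc] at h
      exact .head (y := (R.run (y ++ [a]), letterPerm n a i))
        (.single ⟨a, R.trans_run y a, hi.1, rfl, Nat.le_of_lt_succ hz.1⟩) h
    · have h := walk_of_uncut hz.2 hi.2
      rw [List.append_assoc] at h
      refine ⟨_, _, .refl, ⟨a, R.trans_run y a, hi.1, rfl, ?_⟩, h⟩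
      have := hz.1
      simp only [prioAt] at this ha
      show R.prio (R.run y) a (R.run (y ++ [a])) = P
      omega

variable (R)

/-! ### Settled words and extension steps. -/

/-- The states and permutations reached after `y` by words without cuts can be reached again after
any further word without cuts. -/
def Settled (y : List Letter) : Prop :=
  ∀ u v, none ∉ u → none ∉ v → ∃ v', none ∉ v' ∧ R.run (y ++ v ++ v') = R.run (y ++ u) ∧
    wordPerm n (v ++ v') = wordPerm n u

variable {R}

theorem Settled.append {y u : List Letter} (hy : R.Settled y) (hu : none ∉ u) :
    R.Settled (y ++ u) := by
  intro a b ha hb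
  obtain ⟨v', h1, h2, h3⟩ := hy (u ++ a) (u ++ b) (by simp [hu, ha]) (by simp [hu, hb])
  refine ⟨v', h1, by simpa using h2, ?_⟩
  rw [List.append_assoc, wordPerm_append _ u, wordPerm_append _ u] at h3
  exact mul_right_cancel h3

/-- A cut-free extension that minimises the finite set of pairs reachable by further cut-free words
works, since later extensions cannot shrink this set. -/
theorem exists_settled [Finite Q] (R : TrackRun n Q) (y : List Letter) :
    ∃ u, none ∉ u ∧ R.Settled (y ++ u) := by
  let F : List Letter → Set (Q × Equiv.Perm (Track n)) := fun u =>
    {p | ∃ u', none ∉ u' ∧ p = (R.run (y ++ (u ++ u')), wordPerm n (u ++ u'))}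
  obtain ⟨u, hu, hmin⟩ := (measure fun u => (F u).ncard).wf.has_min {u | none ∉ u} ⟨[], by simp⟩
  refine ⟨u, hu, fun a b ha hb => ?_⟩
  have hu' : none ∉ u := hu
  have hsub : F (u ++ b) ⊆ F u := by
    rintro p ⟨u', h1, rfl⟩
    exact ⟨b ++ u', by simp [hb, h1], by simp⟩
  have heq : F (u ++ b) = F u := Set.eq_of_subset_of_ncard_le hsub
    (not_lt.1 (hmin (u ++ b) (by simp [hu', hb]))) (Set.toFinite _)
  have hmem : (R.run (y ++ (u ++ a)), wordPerm n (u ++ a)) ∈ F (u ++ b) :=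
    heq ▸ ⟨a, ha, rfl⟩
  obtain ⟨v', h1, h2⟩ := hmem
  rw [Prod.mk.injEq] at h2
  refine ⟨v', h1, by simpa using h2.1.symm, ?_⟩
  have h3 := h2.2
  rw [List.append_assoc, wordPerm_append _ u, wordPerm_append _ u] at h3
  exact (mul_right_cancel h3).symm

variable (R)

/-- Extension by a word with at most one cut to a settled word. -/
def Step (y y' : List Letter) : Prop :=
  R.Settled y' ∧ ∃ z, y' = y ++ z ∧ z.count none ≤ 1

/-- All priorities met on extension steps after `y` are less than `p`. -/
def Bounded (p : ℕ) (y : List Letter) : Prop :=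
  ∀ y', Relation.ReflTransGen R.Step y y' → ∀ z, R.Step y' (y' ++ z) → R.Below p y' z

variable {R}

theorem Bounded.mono {p : ℕ} {y y' : List Letter} (h : R.Bounded p y)
    (hy : Relation.ReflTransGen R.Step y y') : R.Bounded p y' :=
  fun _ h1 => h _ (hy.trans h1)

theorem settled_of_steps {y y' : List Letter} (hy : R.Settled y)
    (h : Relation.ReflTransGen R.Step y y') : R.Settled y' := by
  induction h with
  | refl => exact hy
  | tail _ h _ => exact h.1

theorem exists_append_of_steps {p : ℕ} {y y' : List Letter} (hb : R.Bounded p y)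
    (h : Relation.ReflTransGen R.Step y y') : ∃ z, y' = y ++ z ∧ R.Below p y z := by
  induction h with
  | refl => exact ⟨[], by simp, fun s a s' h => by simp at h⟩
  | tail h h' ih =>
    obtain ⟨z, rfl, hz⟩ := ih
    obtain ⟨hs, z', rfl, hc⟩ := h'
    exact ⟨z ++ z', by simp, below_append.2 ⟨hz, hb _ h _ ⟨hs, z', rfl, hc⟩⟩⟩

theorem head?_of_steps {y y' : List Letter} {a : Letter} (hy : y.head? = some a)
    (h : Relation.ReflTransGen R.Step y y') : y'.head? = some a := by
  induction h with
  | refl => exact hy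
  | tail _ h ih =>
    obtain ⟨-, z, rfl, -⟩ := h
    simp [ih]

theorem Settled.step_append {y u : List Letter} (hy : R.Settled y) (hu : none ∉ u) :
    R.Step y (y ++ u) :=
  ⟨hy.append hu, u, rfl, by simp [List.count_eq_zero.2 hu]⟩

/-- Any track can be cut within one step. -/
theorem exists_cut_step [Finite Q] (R : TrackRun n Q) (y : List Letter) (i : Track n) :
    ∃ u u', R.Step y (y ++ (u ++ none :: u')) ∧ wordPerm n u i = 0 := by
  -- The track is moved to position `0`, cut there, and a cut-free word then settles the result.
  obtain ⟨u, hu, hp⟩ := exists_wordPerm_eq n (Equiv.swap i 0)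
  obtain ⟨u', hu', hs⟩ := R.exists_settled (y ++ (u ++ [none]))
  refine ⟨u, u', ⟨?_, _, rfl, ?_⟩, by rw [hp, Equiv.swap_apply_left]⟩
  · simpa using hs
  · simp [List.count_append, List.count_eq_zero.2 hu, List.count_eq_zero.2 hu']

/-! ### Counting the low tracks. -/

variable (R) in
/-- The positions of rank less than `v` after `y`. -/
noncomputable def lowTracks (P v : ℕ) (y : List Letter) : Finset (Track n) :=
  Finset.univ.filter fun i => R.rank P (R.run y, i) < v

theorem mem_lowTracks {P v : ℕ} {y : List Letter} {i : Track n} :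
    i ∈ R.lowTracks P v y ↔ R.rank P (R.run y, i) < v := by
  simp [lowTracks]

/-- Words without cuts permute the low tracks of a settled word. -/
theorem mem_lowTracks_append_iff [Finite Q] {P v : ℕ} {y u : List Letter} (hy : R.Settled y)
    (hb : R.Bounded (P + 1) y) (hu : none ∉ u) (i : Track n) :
    wordPerm n u i ∈ R.lowTracks P v (y ++ u) ↔ i ∈ R.lowTracks P v y := by
  have h1 : R.rank P (R.run (y ++ u), wordPerm n u i) ≤ R.rank P (R.run y, i) :=
    rank_le (walk_of_uncut (hb y .refl u (hy.step_append hu)) (uncut_of_notMem hu i))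
  -- Settledness leads back to the same state and positions, so the rank cannot have dropped.
  obtain ⟨u', hu', hrun, hperm⟩ := hy [] u (by simp) hu
  have h2 := rank_le (walk_of_uncut
    (hb (y ++ u) (.single (hy.step_append hu)) u' ((hy.append hu).step_append hu'))
    (uncut_of_notMem hu' (wordPerm n u i)))
  rw [hrun, List.append_nil, ← Equiv.Perm.mul_apply, ← wordPerm_append, hperm] at h2
  have h3 : R.rank P (R.run y, i) ≤ R.rank P (R.run (y ++ u), wordPerm n u i) := h2
  rw [mem_lowTracks, mem_lowTracks, le_antisymm h1 h3]

/-- If half of the tracks are low after a settled word, then every half of the tracks is the set of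
low tracks of some state. -/
theorem choose_le_card [Fintype Q] {P v : ℕ} {y : List Letter} (hy : R.Settled y)
    (hb : R.Bounded (P + 1) y) (hcard : (R.lowTracks P v y).card = n + 1) :
    (2 * n + 2).choose (n + 1) ≤ Fintype.card Q := by
  have hex : ∀ Y : Finset (Track n), Y.card = n + 1 →
      ∃ u, none ∉ u ∧ R.lowTracks P v (y ++ u) = Y := by
    intro Y hY
    let e := Finset.equivOfCardEq (hcard.trans hY.symm)
    obtain ⟨u, hu, hp⟩ := exists_wordPerm_eq n (Equiv.extendSubtype e)
    refine ⟨u, hu, (Finset.eq_of_subset_of_card_le (fun j hj => ?_) ?_).symm⟩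
    · have hj' : j = wordPerm n u ((wordPerm n u)⁻¹ j) := by simp
      rw [hj', mem_lowTracks_append_iff hy hb hu]
      by_contra hn
      have := Equiv.extendSubtype_not_mem e _ hn
      rw [← hp, ← hj'] at this
      exact this hj
    · rw [hY, ← hcard]
      refine Finset.card_le_card_of_injOn ⇑(wordPerm n u)⁻¹ (fun j hj => ?_)
        (wordPerm n u)⁻¹.injective.injOn
      rw [Finset.mem_coe, ← mem_lowTracks_append_iff hy hb hu]
      simpa using hj
  choose! u hu1 hu2 using hex
  have h := Finset.card_le_card_of_injOn (s := Finset.powersetCard (n + 1) Finset.univ)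
    (t := Finset.univ) (fun Y : Finset (Track n) => R.run (y ++ u Y)) (fun _ _ => by simp) ?_
  · simpa using h
  · intro Y hY Y' hY' heq
    have hY := (Finset.mem_powersetCard.1 hY).2
    have hY' := (Finset.mem_powersetCard.1 hY').2
    -- Ranks depend on the word only through the state of the run.
    rw [← hu2 Y hY, ← hu2 Y' hY']
    ext i
    rw [mem_lowTracks, mem_lowTracks]
    dsimp only at heq
    rw [heq]

/-- One step loses at most one low track. -/
theorem card_lowTracks_le {P v v' : ℕ} {y z : List Letter} (hz : z.count none ≤ 1)
    (h : ∀ i, Uncut n i z → R.rank P (R.run y, i) < v →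
      R.rank P (R.run (y ++ z), wordPerm n z i) < v') :
    (R.lowTracks P v y).card ≤ (R.lowTracks P v' (y ++ z)).card + 1 := by
  obtain ⟨i₀, hi₀⟩ := exists_uncut (n := n) hz
  have h1 : ((R.lowTracks P v y).erase i₀).card ≤ (R.lowTracks P v' (y ++ z)).card := by
    refine Finset.card_le_card_of_injOn (wordPerm n z) (fun i hi => ?_)
      (wordPerm n z).injective.injOn
    have hi := Finset.mem_erase.1 hi
    exact mem_lowTracks.2 (h i (hi₀ i hi.1) (mem_lowTracks.1 hi.2))
  have h2 := Finset.pred_card_le_card_erase (s := R.lowTracks P v y) (a := i₀)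
  omega

/-- The least attainable threshold cannot leave more than half of the tracks low forever, since the
next occurrence of `P` lowers the ranks of all but at most one of them. As a step loses at most one
low track, exactly half is attained. -/
theorem choose_le_card_of_even [Fintype Q] {P : ℕ} (hP : Even P) {y : List Letter}
    (hfirst : y.head? = some R.first) (hy : R.Settled y) (hb : R.Bounded (P + 1) y)
    (htop : ∀ y', Relation.ReflTransGen R.Step y y' → ¬ R.Bounded P y') :
    (2 * n + 2).choose (n + 1) ≤ Fintype.card Q := by
  classical
  have hex : ∃ v y', Relation.ReflTransGen R.Step y y' ∧ n + 1 ≤ (R.lowTracks P v y').card := by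
    -- Above the number of vertices, every rank is low.
    refine ⟨Nat.card (Q × Track n) + 1, y, .refl, ?_⟩
    have : R.lowTracks P (Nat.card (Q × Track n) + 1) y = Finset.univ := by
      ext i
      simp only [mem_lowTracks, Finset.mem_univ, iff_true, Nat.lt_succ_iff]
      exact Set.ncard_le_card _
    rw [this, Finset.card_univ, Fintype.card_fin]
    omega
  obtain ⟨y₁, hy₁, hcard₁⟩ := Nat.find_spec hex
  set v := Nat.find hex with hv
  by_cases hhalf : ∃ y₂, Relation.ReflTransGen R.Step y₁ y₂ ∧
      (R.lowTracks P v y₂).card = n + 1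
  · obtain ⟨y₂, hy₂, hcard₂⟩ := hhalf
    exact choose_le_card (settled_of_steps hy (hy₁.trans hy₂)) (hb.mono (hy₁.trans hy₂)) hcard₂
  exfalso
  push Not at hhalf
  have hbig : ∀ y₂, Relation.ReflTransGen R.Step y₁ y₂ →
      n + 1 < (R.lowTracks P v y₂).card := by
    intro y₂ hy₂
    induction hy₂ with
    | refl => exact lt_of_le_of_ne hcard₁ (hhalf _ .refl).symm
    | tail h h' ih =>
      have hne := hhalf _ (h.tail h')
      obtain ⟨hs, z, rfl, hz⟩ := h'
      have hbel := hb _ (hy₁.trans h) z ⟨hs, z, rfl, hz⟩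
      have := card_lowTracks_le (R := R) (P := P) (v := v) (v' := v) hz fun i hi hr =>
        (rank_le (walk_of_uncut hbel hi)).trans_lt hr
      omega
  have hnot := htop y₁ hy₁
  simp only [Bounded, not_forall] at hnot
  obtain ⟨y₂, hy₂, z, hstep, hz⟩ := hnot
  have hbel := hb _ (hy₁.trans hy₂) z hstep
  have hfirst' : (y₂ ++ z).head? = some R.first :=
    head?_of_steps hfirst ((hy₁.trans hy₂).tail hstep)
  have hcount : z.count none ≤ 1 := by
    obtain ⟨-, z', hz', hc⟩ := hstep
    rwa [List.append_cancel_left hz']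
  have hle := card_lowTracks_le (R := R) (P := P) (v := v) (v' := v - 1) (y := y₂) (z := z)
    hcount fun i hi hr => by
    have := rank_lt (descends_of_uncut hbel hi hz) (not_descends_self hP hfirst' (wordPerm n z i))
    omega
  have hbig₂ := hbig y₂ hy₂
  have hvpos : 0 < v := by
    obtain ⟨i, hi⟩ := Finset.card_pos.1 (by omega : 0 < (R.lowTracks P v y₂).card)
    exact (Nat.zero_le _).trans_lt (mem_lowTracks.1 hi)
  exact Nat.find_min hex (m := v - 1) (by omega)
    ⟨_, (hy₁.trans hy₂).tail hstep, by omega⟩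

/-- Extensions that meet `P` and extensions that cut a prescribed track alternate. The limit word
lies in `words`, and its run has limit priority `P`. -/
theorem even_of_bounded [Finite Q] {P : ℕ} {y : List Letter}
    (hfirst : y.head? = some R.first) (hb : R.Bounded (P + 1) y)
    (htop : ∀ y', Relation.ReflTransGen R.Step y y' → ¬ R.Bounded P y') : Even P := by
  have hprog : ∀ (x : {y' // Relation.ReflTransGen R.Step y y'}) (i : Track n),
      ∃ x' : {y' // Relation.ReflTransGen R.Step y y'}, ∃ z, x'.1 = x.1 ++ z ∧
        (∃ s a s', z = s ++ a :: s' ∧ P ≤ R.prioAt (x.1 ++ s) a) ∧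
        ∃ s s', z = s ++ none :: s' ∧ wordPerm n (x.1 ++ s) i = 0 := by
    rintro ⟨x, hx⟩ i
    have hnot := htop x hx
    simp only [Bounded, not_forall] at hnot
    obtain ⟨y₁, hy₁, z₁, hstep, hz₁⟩ := hnot
    simp only [Below, not_forall, not_lt] at hz₁
    obtain ⟨s, a, s', rfl, hs⟩ := hz₁
    obtain ⟨z₀, rfl, -⟩ := exists_append_of_steps (hb.mono hx) hy₁
    obtain ⟨u, u', hcut, hu⟩ := R.exists_cut_step (x ++ z₀ ++ (s ++ a :: s'))
      (wordPerm n (x ++ z₀ ++ (s ++ a :: s')) i)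
    refine ⟨⟨_, ((hx.trans hy₁).tail hstep).tail hcut⟩,
      z₀ ++ (s ++ a :: s') ++ (u ++ none :: u'), by simp, ⟨z₀ ++ s, a, _, by simp; rfl, ?_⟩,
      ⟨z₀ ++ (s ++ a :: s') ++ u, u', by simp, ?_⟩⟩
    · simpa using hs
    · rw [← List.append_assoc, wordPerm_append, Equiv.Perm.mul_apply, ← List.append_assoc]
      exact hu
  choose next z hz1 hz2 hz3 using hprog
  -- Extension number `k` cuts the track `k` modulo the number of tracks.
  let g : ℕ → {y' // Relation.ReflTransGen R.Step y y'} :=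
    fun k => Nat.rec ⟨y, .refl⟩ (fun k x => next x (Fin.ofNat _ k)) k
  have hg : ∀ k, (g (k + 1)).1 = (g k).1 ++ z (g k) (Fin.ofNat _ k) := fun k => hz1 _ _
  obtain ⟨hlen, w, hw⟩ := exists_limit_word (y := fun k => (g k).1) fun k => by
    refine ⟨_, ?_, hg k⟩
    obtain ⟨s, s', h, -⟩ := hz3 (g k) (Fin.ofNat _ k)
    exact h ▸ by simp
  have hfind : ∀ k s a s', z (g k) (Fin.ofNat _ k) = s ++ a :: s' →
      wordPrefix w ((g k).1 ++ s).length = (g k).1 ++ s ∧ w ((g k).1 ++ s).length = a := by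
    intro k s a s' h
    refine wordPrefix_eq_of_append (L := (g (k + 1)).1.length) (r := s') ?_
    rw [hw (k + 1), hg, h, List.append_assoc]
  have hge : ∀ k s, k ≤ ((g k).1 ++ s).length := fun k s =>
    (hlen k).trans (by simp)
  have hprio : ∀ t, R.prio (R.run (wordPrefix w t)) (w t) (R.run (wordPrefix w (t + 1))) =
      R.prioAt (wordPrefix w t) (w t) := fun t => by rw [wordPrefix_succ]; rfl
  have hw0 : w 0 = R.first := by
    have h0 : wordPrefix w y.length = y := hw 0
    obtain ⟨r, hr⟩ := List.head?_eq_some_iff.1 hfirst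
    exact (wordPrefix_eq_of_append (x := []) (h0.trans hr)).2
  have hcuts : CutsAll n w := by
    refine fun i => frequently_atTop.2 fun T => ?_
    -- The extension with this number treats the track `i` and starts no earlier than time `T`.
    have hi : Fin.ofNat (2 * n + 2) (T * (2 * n + 2) + i.val) = i := by
      ext
      simp [Fin.ofNat, Nat.mod_eq_of_lt i.isLt]
    obtain ⟨s, s', h1, h2⟩ := hz3 (g (T * (2 * n + 2) + i.val))
      (Fin.ofNat _ (T * (2 * n + 2) + i.val))
    obtain ⟨h3, h4⟩ := hfind _ _ _ _ h1
    refine ⟨_, le_trans ?_ (hge _ s), h4, ?_⟩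
    · nlinarith
    · rw [h3]
      rwa [hi] at h2
  have hup : ∀ᶠ t in atTop,
      R.prio (R.run (wordPrefix w t)) (w t) (R.run (wordPrefix w (t + 1))) ≤ P := by
    refine eventually_atTop.2 ⟨y.length, fun t ht => ?_⟩
    rw [hprio]
    obtain ⟨z', h1, h2⟩ := exists_append_of_steps hb (g (t + 1)).2
    obtain ⟨r, hr⟩ := exists_wordPrefix_eq w (hlen (t + 1))
    obtain ⟨l, rfl⟩ := Nat.exists_eq_add_of_le ht
    have h3 : y ++ z' = wordPrefix w (y.length + l) ++ w (y.length + l) :: r := by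
      rw [← hr, ← h1]; exact (hw (y.length + l + 1)).symm
    have h4 : wordPrefix w (y.length + l) = y ++ z'.take l := by
      have := congrArg (List.take (y.length + l)) h3
      rw [List.take_length_add_append, List.take_left' (length_wordPrefix _ _)] at this
      exact this.symm
    rw [h4, List.append_assoc] at h3
    have h5 := h2 _ _ _ (List.append_cancel_left h3)
    rw [← h4] at h5
    omega
  have hoften : ∃ᶠ t in atTop,
      R.prio (R.run (wordPrefix w t)) (w t) (R.run (wordPrefix w (t + 1))) = P := by
    have : ∃ᶠ t in atTop,
        P ≤ R.prio (R.run (wordPrefix w t)) (w t) (R.run (wordPrefix w (t + 1))) := by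
      refine frequently_atTop.2 fun k => ?_
      obtain ⟨s, a, s', h1, h2⟩ := hz2 (g k) (Fin.ofNat _ k)
      obtain ⟨h3, h4⟩ := hfind _ _ _ _ h1
      exact ⟨_, hge k s, by rwa [hprio, h3, h4]⟩
    exact (this.and_eventually hup).mono fun t ht => le_antisymm ht.2 ht.1
  exact (R.complete w ((R.mem_words_iff w hw0).2 hcuts)).eq_limsup hoften hup

/-- The least bound on priorities that is attainable after some settled word is of the form `P + 1`.
Minimality makes `P` recur after every further sequence of steps. -/
theorem choose_le_card_states [Fintype Q] (R : TrackRun n Q) :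
    (2 * n + 2).choose (n + 1) ≤ Fintype.card Q := by
  classical
  have hex : ∃ p y, y.head? = some R.first ∧ R.Settled y ∧ R.Bounded p y := by
    obtain ⟨u, -, hu⟩ := R.exists_settled [R.first]
    exact ⟨R.bound + 1, [R.first] ++ u, by simp, hu,
      fun _ _ _ _ _ _ _ _ => Nat.lt_succ_of_le (R.prio_le _ _ _)⟩
  obtain ⟨y, hfirst, hy, hb⟩ := Nat.find_spec hex
  -- A step with a cut reads a letter, and no priority is less than `0`.
  have hpos : Nat.find hex ≠ 0 := by
    intro h0
    rw [h0] at hb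
    obtain ⟨u, u', hstep, -⟩ := R.exists_cut_step y 0
    exact absurd (hb y .refl _ hstep u none u' rfl) (Nat.not_lt_zero _)
  obtain ⟨P, hP⟩ := Nat.exists_eq_succ_of_ne_zero hpos
  rw [hP] at hb
  have htop : ∀ y', Relation.ReflTransGen R.Step y y' → ¬ R.Bounded P y' := fun y' hy' h =>
    Nat.find_min hex (m := P) (by omega)
      ⟨y', head?_of_steps hfirst hy', settled_of_steps hy hy', h⟩
  exact choose_le_card_of_even (even_of_bounded hfirst hb htop) hfirst hy hb htop

end TrackRun

/-! ### Exponential bounds and the conclusion. -/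

theorem two_pow_le_choose (n : ℕ) : 2 ^ n ≤ (2 * n + 2).choose (n + 1) := by
  have h : ∀ m : ℕ, 2 ^ m ≤ Nat.centralBinom m := by
    intro m
    induction m with
    | zero => simp
    | succ m ih =>
      have h1 := Nat.succ_mul_centralBinom_succ m
      have h2 : (m + 1) * (2 * 2 ^ m) ≤ (m + 1) * Nat.centralBinom (m + 1) := by
        rw [h1]
        nlinarith
      rw [pow_succ']
      exact Nat.le_of_mul_le_mul_left h2 (Nat.succ_pos m)
  exact (Nat.pow_le_pow_right two_pos n.le_succ).trans (h (n + 1))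

namespace AltParityAutomaton

theorem exists_priority_bound {A : Type} (M : AltParityAutomaton A) :
    ∃ B, ∀ q a q', M.priority q a q' ≤ B :=
  ⟨M.priorities.sup id, fun q a q' => Finset.le_sup (f := id) (M.priority_mem q a q')⟩

theorem card_state_le_size {A : Type} [Fintype A] (M : AltParityAutomaton A) :
    letI := M.fintypeState
    Fintype.card M.State ≤ M.size :=
  le_max_of_le_right (le_max_left _ _)

theorem two_pow_le_size_of_isNondeterministic {n : ℕ} {M : AltParityAutomaton Letter}
    (hM : M.IsNondeterministic) (hgfg : M.IsExistsGFG) (hL : M.language = trackLanguage n) :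
    2 ^ n ≤ M.size := by
  let _ := M.fintypeState
  obtain ⟨B, hB⟩ := M.exists_priority_bound
  obtain ⟨σ, hσ⟩ := hgfg
  -- Without conjunctions, Adam's strategy has no effect, so a constant will do.
  let τ : ChoiceStrategy Letter := fun _ _ _ => false
  let R : TrackRun n M.State :=
    { trans := M.Transition
      prio := M.priority
      bound := B
      prio_le := hB
      run := fun x => (M.run σ τ x).1
      trans_run := M.transition_run σ τ
      words := M.language
      first := none
      mem_words_iff := fun w hw => by simp [hL, trackLanguage, hw]
      sound := fun w s h0 hs hacc => hM.mem_language h0 hs hacc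
      complete := fun w hw =>
        (hσ w _ (M.eveFollows_playOf σ τ w)).resolve_left (not_not.2 hw) }
  exact (two_pow_le_choose n).trans (R.choose_le_card_states.trans M.card_state_le_size)

theorem two_pow_le_size_of_isUniversal {n : ℕ} {M : AltParityAutomaton Letter}
    (hM : M.IsUniversal) (hgfg : M.IsForallGFG) (hL : M.language = trackLanguage n) :
    2 ^ n ≤ M.size := by
  let _ := M.fintypeState
  obtain ⟨B, hB⟩ := M.exists_priority_bound
  obtain ⟨τ, hτ⟩ := hgfg
  let σ : ChoiceStrategy Letter := fun _ _ _ => false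
  let R : TrackRun n M.State :=
    { trans := M.Transition
      -- The shift makes the rejecting paths of `M` the accepting ones, and a rejecting path of a
      -- universal automaton proves that the word is not in its language.
      prio := fun q a q' => M.priority q a q' + 1
      bound := B + 1
      prio_le := fun q a q' => Nat.succ_le_succ (hB q a q')
      run := fun x => (M.run σ τ x).1
      trans_run := M.transition_run σ τ
      words := M.languageᶜ
      -- After the swap, the complement consists of the words that cut every track infinitely often.
      first := some true
      mem_words_iff := fun w hw => by simp [hL, trackLanguage, hw]
      sound := fun w s h0 hs hacc hw =>
        (parityAccepting_add_one_iff fun i => hB _ _ _).1 hacc (hM.accepting h0 hs hw)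
      complete := fun w hw => (parityAccepting_add_one_iff fun i => hB _ _ _).2
        ((hτ w _ (M.adamFollows_playOf σ τ w)).resolve_left hw) }
  exact (two_pow_le_choose n).trans (R.choose_le_card_states.trans M.card_state_le_size)

end AltParityAutomaton

theorem trackAutomaton_size_isTheta :
    (fun n => ((trackAutomaton n).size : ℝ)) =Θ[atTop] fun n => (n : ℝ) := by
  refine ⟨IsBigO.of_bound 45 ?_, IsBigO.of_bound 1 ?_⟩
  · filter_upwards [eventually_ge_atTop 1] with n hn
    have h : (trackAutomaton n).size ≤ 45 * n := (trackAutomaton_size_le n).trans (by omega)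
    simp only [Real.norm_natCast]
    exact_mod_cast h
  · refine Eventually.of_forall fun n => ?_
    simp only [Real.norm_natCast, one_mul]
    exact_mod_cast le_trackAutomaton_size n

theorem mainTheorem4 :
    ∃ (A : Type) (_ : Fintype A) (_ : Nonempty A) (C : ℕ → AltParityAutomaton A),
      (∀ n, (C n).IsGFG ∧ (C n).priorities = {0, 1, 2}) ∧
      ((fun n => ((C n).size : ℝ)) =Θ[atTop] fun n => (n : ℝ)) ∧
      ∃ c : ℝ, 0 < c ∧ ∀ᶠ n : ℕ in atTop, ∀ E : AltParityAutomaton A,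
        (E.IsNondeterministic ∨ E.IsUniversal) → E.IsGFG → E.language = (C n).language →
          (2 : ℝ) ^ (c * (n : ℝ)) ≤ (E.size : ℝ) := by
  refine ⟨Letter, inferInstance, inferInstance, trackAutomaton,
    fun n => ⟨(trackAutomaton_isGFG_and_language n).1, rfl⟩, trackAutomaton_size_isTheta,
    1, one_pos, Eventually.of_forall fun n E hE hgfg hL => ?_⟩
  rw [(trackAutomaton_isGFG_and_language n).2] at hL
  have h : 2 ^ n ≤ E.size := hE.elim
    (fun h => AltParityAutomaton.two_pow_le_size_of_isNondeterministic h hgfg.1 hL)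
    (fun h => AltParityAutomaton.two_pow_le_size_of_isUniversal h hgfg.2 hL)
  rw [one_mul, Real.rpow_natCast]
  exact_mod_cast h
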